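/- Let $(X,\Sigma,\mathfrak m)$ be a $\sigma$-finite measure space and let $\mathbb B$ be a separable real Banach space. Let $\mathbf E$ be a Banach $\mathbb B$-bundle over $X$, that is, a map assigning to every $x\in X$ a closed linear subspace $\mathbf E(x)\subseteq\mathbb B$ such that $\{x\in X:\mathbf E(x)\cap U\neq\varnothing\}\in\Sigma$ for every open set $U\subseteq\mathbb B$. Suppose that $\mathbf E$ is reflexive, i.e. that $\mathbf E(x)$ is a reflexive Banach space for $\mathfrak m$-a.e. $x\in X$. For $p\in(1,\infty)$ let $\Gamma_p(\mathbf E)$ be the space of all strongly measurable maps $v\colon X\to\mathbb B$ with $v(x)\in\mathbf E(x)$ for every $x\in X$ and $\int\|v(x)\|_{\mathbb B}^p\,d\mathfrak m(x)<\infty$, modulo equality $\mathfrak m$-a.e., with the norm $\|v\|=\big(\int\|v(x)\|_{\mathbb B}^p\,d\mathfrak m(x)\big)^{1/p}$ and the pointwise multiplication by functions in $L^\infty(\mathfrak m)$. Then for every $p\in(1,\infty)$ the space $\Gamma_p(\mathbf E)$ is reflexive, both as a Banach space and as an $L^p(\mathfrak m)$-normed $L^\infty(\mathfrak m)$-module.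 Here reflexivity as a module means the following. Let $\frac1p+\frac1q=1$. The module dual $\Gamma_p(\mathbf E)^*$ is the space of all continuous $L^\infty(\mathfrak m)$-linear maps $\omega\colon\Gamma_p(\mathbf E)\to L^1(\mathfrak m)$. For such an $\omega$ let $|\omega|\in L^q(\mathfrak m)$ be the essential supremum of the functions $\omega(v)$ over all $v\in\Gamma_p(\mathbf E)$ with $\|v(\cdot)\|_{\mathbb B}\le1$ $\mathfrak m$-a.e., and put $\|\omega\|=\big\||\omega|\big\|_{L^q(\mathfrak m)}$. Then for every continuous $L^\infty(\mathfrak m)$-linear map $L\colon\Gamma_p(\mathbf E)^*\to L^1(\mathfrak m)$ there is $v\in\Gamma_p(\mathbf E)$ such that $L(\omega)=\omega(v)$ for every $\omega\in\Gamma_p(\mathbf E)^*$. -/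

import Mathlib

open MeasureTheory
open scoped ENNReal

noncomputable section

/-- A real normed space is reflexive if its canonical embedding into its bidual is onto. -/
def IsReflexiveSpace (V : Type*) [NormedAddCommGroup V] [NormedSpace ℝ V] : Prop :=
  Function.Surjective (NormedSpace.inclusionInDoubleDual ℝ V)

/-- A Banach `B`-bundle on the measurable space `X`: a weakly measurable multivalued map
from `X` to `B` whose values are closed linear subspaces of `B`. -/
structure BanachBundle (X : Type*) [MeasurableSpace X] (B : Type*) [NormedAddCommGroup B]
    [NormedSpace ℝ B] where
  /-- The fiber over a point. -/
  fiber : X → Submodule ℝ B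
  isClosed_fiber : ∀ x, IsClosed (fiber x : Set B)
  weaklyMeasurable : ∀ U : Set B, IsOpen U →
    MeasurableSet {x | ((fiber x : Set B) ∩ U).Nonempty}

namespace BanachBundle

variable {X : Type*} [MeasurableSpace X] {B : Type*} [NormedAddCommGroup B] [NormedSpace ℝ B]

/-- The bundle is reflexive: almost every fiber is a reflexive Banach space. -/
def IsReflexive (E : BanachBundle X B) (μ : Measure X) : Prop :=
  ∀ᵐ x ∂μ, IsReflexiveSpace (E.fiber x)

/-- A section: a strongly measurable map `v` with `v x ∈ E x` for every `x`. -/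
def IsSection (E : BanachBundle X B) (v : X → B) : Prop :=
  StronglyMeasurable v ∧ ∀ x, v x ∈ E.fiber x

/-- The space of `p`-integrable sections modulo a.e. equality, as a subspace of the
Lebesgue--Bochner space; it carries the norm of the latter. -/
def sectionSpace (E : BanachBundle X B) (p : ℝ≥0∞) (μ : Measure X) :
    Submodule ℝ (Lp B p μ) where
  carrier := {u | ∃ v : X → B, E.IsSection v ∧ u =ᵐ[μ] v}
  zero_mem' := ⟨fun _ => 0, ⟨stronglyMeasurable_const, fun x => (E.fiber x).zero_mem⟩,
    Lp.coeFn_zero B p μ⟩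
  add_mem' := by
    rintro u₁ u₂ ⟨v₁, h₁, e₁⟩ ⟨v₂, h₂, e₂⟩
    exact ⟨v₁ + v₂, ⟨h₁.1.add h₂.1, fun x => (E.fiber x).add_mem (h₁.2 x) (h₂.2 x)⟩,
      (Lp.coeFn_add u₁ u₂).trans (e₁.add e₂)⟩
  smul_mem' := by
    rintro c u ⟨v, h, e⟩
    exact ⟨c • v, ⟨h.1.const_smul c, fun x => (E.fiber x).smul_mem c (h.2 x)⟩,
      (Lp.coeFn_smul c u).trans (e.const_smul c)⟩

/-- Pointwise multiplication of a `p`-integrable section by an essentially bounded function. -/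
def mulSection {E : BanachBundle X B} {p : ℝ≥0∞} {μ : Measure X}
    (f : Lp ℝ ∞ μ) (u : E.sectionSpace p μ) : E.sectionSpace p μ :=
  ⟨f • (u : Lp B p μ), by
    obtain ⟨v, h, e⟩ := u.2
    refine ⟨fun x => f x • v x, ⟨(Lp.stronglyMeasurable f).smul h.1,
      fun x => (E.fiber x).smul_mem _ (h.2 x)⟩, ?_⟩
    filter_upwards [Lp.coeFn_lpSMul (r := p) f (u : Lp B p μ), e] with x hx hv
    simp [hx, hv]⟩

/-- The module dual of the section space: the continuous `L^∞`-linear maps from the section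
space to `L^1`. -/
def moduleDual (E : BanachBundle X B) (p : ℝ≥0∞) (μ : Measure X) [Fact (1 ≤ p)] :
    Submodule ℝ (E.sectionSpace p μ →L[ℝ] Lp ℝ 1 μ) where
  carrier := {T | ∀ (f : Lp ℝ ∞ μ) (v : E.sectionSpace p μ),
    T (mulSection f v) = (f • T v : Lp ℝ 1 μ)}
  zero_mem' := by intro f v; simp
  add_mem' := by
    intro S T hS hT f v
    rw [add_apply, add_apply, hS f v, hT f v]
    exact (Lp.add_smul f (S v) (T v)).symm
  smul_mem' := by
    intro c T hT f v
    simp [hT f v, Lp.smul_comm]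

/-- Multiplication of an element of the module dual by an essentially bounded function,
`(f • ω) v = f • ω v`. -/
def mulDual {E : BanachBundle X B} {p : ℝ≥0∞} {μ : Measure X} [Fact (1 ≤ p)]
    (f : Lp ℝ ∞ μ) (ω : E.moduleDual p μ) : E.moduleDual p μ :=
  ⟨LinearMap.mkContinuous
    { toFun := fun v => (f • ω.1 v : Lp ℝ 1 μ)
      map_add' := fun v w => by
        rw [map_add]
        exact Lp.add_smul f (ω.1 v) (ω.1 w)
      map_smul' := fun c v => by simp [Lp.smul_comm] }
    (‖f‖ * ‖ω.1‖) (fun v => by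
      refine (Lp.norm_smul_le f (ω.1 v)).trans ?_
      rw [mul_assoc]
      exact mul_le_mul_of_nonneg_left (ω.1.le_opNorm v) (norm_nonneg f)), by
    intro g v
    simp only [LinearMap.mkContinuous_apply, LinearMap.coe_mk, AddHom.coe_mk, ω.2 g v]
    refine Lp.ext ?_
    filter_upwards [Lp.coeFn_lpSMul (r := 1) f (g • ω.1 v : Lp ℝ 1 μ),
      Lp.coeFn_lpSMul (r := 1) g (f • ω.1 v : Lp ℝ 1 μ),
      Lp.coeFn_lpSMul (r := 1) g (ω.1 v), Lp.coeFn_lpSMul (r := 1) f (ω.1 v)] with x h1 h2 h3 h4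
    rw [h1, h2, Pi.smul_apply', Pi.smul_apply', h3, h4, Pi.smul_apply', Pi.smul_apply']
    exact smul_comm _ _ _⟩

/-- An a.e. class of real functions regarded as an a.e. class of extended real functions. -/
def toExtended {μ : Measure X} (g : X →ₘ[μ] ℝ) : X →ₘ[μ] EReal :=
  AEEqFun.comp Real.toEReal continuous_coe_real_ereal g

/-- `g` is the pointwise norm `|ω|` of the element `ω` of the module dual: the essential
supremum of the functions `ω v`, where `v` runs over the `p`-integrable sections with
`|v| ≤ 1` a.e. It is unique, being a least upper bound. -/
def IsPointwiseNorm {E : BanachBundle X B} {p : ℝ≥0∞} {μ : Measure X} [Fact (1 ≤ p)]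
    (ω : E.moduleDual p μ) (g : X →ₘ[μ] ℝ) : Prop :=
  IsLUB {h : X →ₘ[μ] EReal | ∃ v : E.sectionSpace p μ,
      (∀ᵐ x ∂μ, ‖(v : Lp B p μ) x‖ ≤ 1) ∧ h = toExtended (ω.1 v : X →ₘ[μ] ℝ)}
    (toExtended g)

/-- The module bidual of the section space: the `L^∞`-linear maps from the module dual to
`L^1` that are continuous, i.e. bounded, for the norm `‖ω‖ = ‖|ω|‖_{L^q}` of the module dual,
where `q` is the conjugate exponent of `p`. -/
def moduleBidual (E : BanachBundle X B) (p : ℝ≥0∞) (μ : Measure X) [Fact (1 ≤ p)] :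
    Set (E.moduleDual p μ →ₗ[ℝ] Lp ℝ 1 μ) :=
  {L | (∀ (f : Lp ℝ ∞ μ) (ω : E.moduleDual p μ), L (mulDual f ω) = (f • L ω : Lp ℝ 1 μ)) ∧
    ∃ C : ℝ, ∀ (ω : E.moduleDual p μ) (g : Lp ℝ p.conjExponent μ),
      IsPointwiseNorm ω (g : X →ₘ[μ] ℝ) → ‖L ω‖ ≤ C * ‖g‖}

/-- The section space is reflexive as a module: its James embedding `v ↦ (ω ↦ ω v)` into
the module bidual is surjective. -/
def IsReflexiveModule (E : BanachBundle X B) (p : ℝ≥0∞) (μ : Measure X) [Fact (1 ≤ p)] :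
    Prop :=
  ∀ L ∈ E.moduleBidual p μ, ∃ v : E.sectionSpace p μ, ∀ ω : E.moduleDual p μ, L ω = ω.1 v

end BanachBundle

end

/-!
Reflexivity of the space of sections is proved by a double limit argument, without a description of
the dual of a fiber that is measurable in the base point.

A Banach space which is not reflexive contains a bounded sequence `v n` and admits a bounded sequence
of functionals `φ k` with `φ k (v n) = 1` for `k ≤ n` and `φ k (v n) = 0` for `n < k`
(`exists_triangular_of_not_isReflexiveSpace`). In the section space, every functional is
`v ↦ ∫ ω v` for a unique element `ω` of the module dual, by the Radon--Nikodym theorem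
(`BanachBundle.integralFunctional_surjective`), and `ω` has a pointwise norm in `L^q`
(`BanachBundle.exists_isPointwiseNorm`). Given countably many sections, `ω` acts on their values at
almost every point `x` through a functional on `B`, by Hahn--Banach
(`BanachBundle.exists_pointwise_functional`). So the triangular pattern is one of integrals of
pointwise pairings `ψ k x (v n x)`.

Replacing both sequences by tails of convex combinations preserves the pattern up to finitely many
terms in each variable. Since bounded sequences in `L^p` and `L^q` have tails of convex combinations
which are dominated and converge almost everywhere (`exists_convexHull_tail_dominated`, from uniform
convexity), both sequences may be assumed to be dominated and all pointwise iterated limits to exist.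
At almost every `x` the iterated limits agree, because the fiber over `x` is reflexive
(`IsReflexiveSpace.tendsto_of_iterated_limits`). By dominated convergence the iterated limits of the
integrals agree as well, while the pattern makes them `1` and `0`: this is
`not_triangular_integral`.

Reflexivity as a module follows: integration turns an element of the module bidual into a functional
on the dual, which is continuous because the pointwise norm is controlled by the norm of the
associated functional, hence is evaluation at a section. Multiplication by bounded functions removes
the integral.
-/

open Filter Topology

/-! ### Reflexivity and interchanging iterated limits -/

/-- **Helly's theorem**: on finitely many functionals, an element of the bidual agrees with a vector whose
norm exceeds its own by at most a constant. -/
theorem exists_forall_apply_eq_of_bidual {V : Type*} [NormedAddCommGroup V] [NormedSpace ℝ V]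
    {ι : Type*} [Fintype ι] (φ : ι → StrongDual ℝ V) (F : StrongDual ℝ (StrongDual ℝ V)) :
    ∃ v : V, ‖v‖ ≤ ‖F‖ + 2 ∧ ∀ i, φ i v = F (φ i) := by
  classical
  set T : V →L[ℝ] (ι → ℝ) := ContinuousLinearMap.pi φ with hT
  set y : ι → ℝ := fun i => F (φ i) with hy
  set U : Set (ι → ℝ) := closure (T '' Metric.closedBall 0 (‖F‖ + 1)) with hU
  have hUc : Convex ℝ U := ((convex_closedBall (0 : V) _).linear_image T.toLinearMap).closure
  -- The target vector is a limit of values of `T` on the ball, by separation in `ι → ℝ`.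
  have hyU : y ∈ U := by
    by_contra hyU
    obtain ⟨f, u, hfu, huf⟩ := geometric_hahn_banach_closed_point hUc isClosed_closure hyU
    have hpos : 0 < ‖F‖ + 1 := by positivity
    set ψ : StrongDual ℝ V := f.comp T with hψ
    have hle : ‖ψ‖ * (‖F‖ + 1) ≤ u := by
      have h1 : ∀ v ∈ Metric.closedBall (0 : V) (‖F‖ + 1), ψ v < u := fun v hv =>
        hfu _ (subset_closure ⟨v, hv, rfl⟩)
      have h2 : ‖ψ‖ ≤ u / (‖F‖ + 1) := by
        refine ContinuousLinearMap.opNorm_bound_of_ball_bound hpos u ψ ?_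
        intro v hv
        rw [Real.norm_eq_abs, abs_le]
        have h3 := h1 v hv
        have h4 := h1 (-v) (by simpa using hv)
        rw [map_neg] at h4
        constructor <;> linarith
      rwa [le_div_iff₀ hpos] at h2
    have hFψ : f y = F ψ := by
      have e1 : ∀ z : ι → ℝ, f z = ∑ i, z i * f (Pi.single i 1) := by
        intro z
        conv_lhs => rw [pi_eq_sum_univ' z]
        rw [map_sum]
        exact Finset.sum_congr rfl fun i _ => by rw [map_smul, smul_eq_mul]
      have e2 : ψ = ∑ i, f (Pi.single i 1) • φ i := by
        ext v
        rw [hψ, ContinuousLinearMap.comp_apply, e1]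
        simp [hT, mul_comm, sum_apply]
      rw [e1, e2, map_sum]
      exact Finset.sum_congr rfl fun i _ => by rw [map_smul, smul_eq_mul, mul_comm]
    have h5 : F ψ ≤ ‖F‖ * ‖ψ‖ := (le_abs_self _).trans (F.le_opNorm ψ)
    nlinarith [norm_nonneg ψ]
  -- The error of the approximation is removed by a bounded linear section of `T`.
  obtain ⟨s, hs⟩ := T.toLinearMap.rangeRestrict.exists_rightInverse_of_surjective
    (LinearMap.range_rangeRestrict _)
  set S : LinearMap.range T.toLinearMap →L[ℝ] V := LinearMap.toContinuousLinearMap s with hS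
  have hyR : y ∈ LinearMap.range T.toLinearMap := by
    have hcl : IsClosed (LinearMap.range T.toLinearMap : Set (ι → ℝ)) :=
      Submodule.closed_of_finiteDimensional _
    refine (closure_minimal ?_ hcl) hyU
    rintro _ ⟨v, -, rfl⟩
    exact ⟨v, rfl⟩
  obtain ⟨_, ⟨v, hv, rfl⟩, hd⟩ := Metric.mem_closure_iff.1 hyU (1 / (‖S‖ + 1)) (by positivity)
  set r : LinearMap.range T.toLinearMap := ⟨y - T v, Submodule.sub_mem _ hyR ⟨v, rfl⟩⟩ with hr
  refine ⟨v + S r, ?_, ?_⟩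
  · have h1 : ‖S r‖ ≤ 1 := by
      refine (S.le_opNorm r).trans ?_
      have h2 : ‖r‖ ≤ 1 / (‖S‖ + 1) := by
        rw [dist_eq_norm] at hd
        exact hd.le
      calc ‖S‖ * ‖r‖ ≤ ‖S‖ * (1 / (‖S‖ + 1)) := by gcongr
        _ ≤ 1 := by
          rw [mul_one_div, div_le_one (by positivity)]
          linarith
    have h3 : ‖v‖ ≤ ‖F‖ + 1 := by simpa using hv
    linarith [norm_add_le v (S r)]
  · have h1 : T (S r) = y - T v := by
      have := LinearMap.congr_fun hs r
      exact congrArg Subtype.val this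
    intro i
    have h2 : T (v + S r) = y := by rw [map_add, h1]; abel
    exact congrFun h2 i

/-- **James' construction**: a non-reflexive Banach space contains a bounded sequence which is
matched with a bounded sequence of functionals in a triangular pattern. -/
theorem exists_triangular_of_not_isReflexiveSpace {V : Type*} [NormedAddCommGroup V]
    [NormedSpace ℝ V] [CompleteSpace V] (hV : ¬ IsReflexiveSpace V) :
    ∃ (K : ℝ) (x : ℕ → V) (f : ℕ → StrongDual ℝ V), (∀ n, ‖x n‖ ≤ K) ∧ (∀ n, ‖f n‖ ≤ K) ∧
      (∀ k n, k ≤ n → f k (x n) = 1) ∧ ∀ k n, n < k → f k (x n) = 0 := by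
  classical
  simp only [IsReflexiveSpace, Function.Surjective, not_forall, not_exists] at hV
  obtain ⟨Φ, hΦ⟩ := hV
  set J := NormedSpace.inclusionInDoubleDual ℝ V with hJ
  -- A functional on the bidual which vanishes on `V` and takes the value `1` at `Φ`.
  obtain ⟨G, hG0, hG1⟩ : ∃ G : StrongDual ℝ (StrongDual ℝ (StrongDual ℝ V)),
      (∀ v, G (J v) = 0) ∧ G Φ = 1 := by
    have hcl : IsClosed (LinearMap.range J.toLinearMap : Set (StrongDual ℝ (StrongDual ℝ V))) := by
      have h := (NormedSpace.inclusionInDoubleDualLi (E := V) ℝ).isometry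
      exact (h.isUniformInducing.isComplete_range).isClosed
    have hmem : Φ ∉ (LinearMap.range J.toLinearMap : Set (StrongDual ℝ (StrongDual ℝ V))) := by
      rintro ⟨v, hv⟩
      exact hΦ v hv
    obtain ⟨G, u, h1, h2⟩ := geometric_hahn_banach_closed_point
      (LinearMap.range J.toLinearMap).convex hcl hmem
    have h3 : ∀ v, G (J v) = 0 := by
      intro v
      by_contra hne
      have h4 := h1 (J ((u / G (J v)) • v)) ⟨_, rfl⟩
      rw [map_smul, map_smul, smul_eq_mul, div_mul_cancel₀ _ hne] at h4
      exact lt_irrefl _ h4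
    have hu : 0 < u := by simpa [h3] using h1 (J 0) ⟨0, rfl⟩
    refine ⟨(G Φ)⁻¹ • G, fun v => by simp [h3], ?_⟩
    simp [inv_mul_cancel₀ (hu.trans h2).ne']
  obtain ⟨C, hC⟩ : ∃ C : ℝ, ∀ (s : Finset (V × StrongDual ℝ V))
      (φ : Option s → StrongDual ℝ (StrongDual ℝ V)), ∃ f, ‖f‖ ≤ C ∧ ∀ i, φ i f = G (φ i) :=
    ⟨_, fun s φ => exists_forall_apply_eq_of_bidual φ G⟩
  set K := max (‖Φ‖ + 2) C with hK
  obtain ⟨z, hz, hz'⟩ := exists_seq_of_forall_finset_exists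
    (P := fun z : V × StrongDual ℝ V => ‖z.1‖ ≤ K ∧ ‖z.2‖ ≤ K ∧ Φ z.2 = 1 ∧ z.2 z.1 = 1)
    (r := fun z z' => z'.2 z.1 = 0 ∧ z.2 z'.1 = 1) (by
      intro s hs
      obtain ⟨f, hf, hf'⟩ := hC s (fun i => i.elim Φ (fun w => J w.1.1))
      have hfΦ : Φ f = 1 := by simpa [hG1] using hf' none
      obtain ⟨x, hx, hx'⟩ := exists_forall_apply_eq_of_bidual
        (fun i : Option s => i.elim f (fun w => w.1.2)) Φ
      refine ⟨(x, f), ⟨hx.trans (le_max_left _ _), hf.trans (le_max_right _ _), hfΦ, ?_⟩, ?_⟩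
      · simpa [hfΦ] using hx' none
      · intro w hw
        refine ⟨?_, ?_⟩
        · exact (hf' (some ⟨w, hw⟩)).trans (hG0 w.1)
        · simpa [(hs w hw).2.2.1] using hx' (some ⟨w, hw⟩))
  refine ⟨K, fun n => (z n).1, fun n => (z n).2, fun n => (hz n).1, fun n => (hz n).2.1, ?_, ?_⟩
  · intro k n hkn
    rcases hkn.eq_or_lt with rfl | h
    · exact (hz k).2.2.2
    · exact (hz' k n h).2
  · intro k n hnk
    exact (hz' n k hnk).1

/-- Bounded sequences of functionals converge pointwise along ultrafilters (Banach--Alaoglu). -/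
theorem exists_forall_tendsto_ultrafilter {V : Type*} [NormedAddCommGroup V] [NormedSpace ℝ V]
    (U : Ultrafilter ℕ) (f : ℕ → StrongDual ℝ V) (C : ℝ) (hf : ∀ n, ‖f n‖ ≤ C) :
    ∃ g : StrongDual ℝ V, ∀ v, Tendsto (fun n => f n v) U (𝓝 (g v)) := by
  have hK := WeakDual.isCompact_closedBall (𝕜 := ℝ) (E := V) 0 C
  obtain ⟨g, -, hg⟩ := hK.ultrafilter_le_nhds (U.map fun n => StrongDual.toWeakDual (f n)) (by
    rw [Ultrafilter.coe_map, le_principal_iff, mem_map]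
    refine Filter.univ_mem' fun n => ?_
    simpa using hf n)
  refine ⟨WeakDual.toStrongDual g, fun v => ?_⟩
  have h1 : Tendsto (fun n => StrongDual.toWeakDual (f n)) U (𝓝 g) := hg
  exact ((WeakDual.eval_continuous v).tendsto g).comp h1

/-- **Grothendieck's double limit property** of reflexive spaces: iterated limits of bounded
sequences may be interchanged. -/
theorem IsReflexiveSpace.tendsto_of_iterated_limits {V : Type*} [NormedAddCommGroup V]
    [NormedSpace ℝ V] (hV : IsReflexiveSpace V) {v : ℕ → V} {ψ : ℕ → StrongDual ℝ V} {C : ℝ}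
    (hv : ∀ n, ‖v n‖ ≤ C) (hψ : ∀ k, ‖ψ k‖ ≤ C) {a b : ℕ → ℝ} {l : ℝ}
    (ha : ∀ k, Tendsto (fun n => ψ k (v n)) atTop (𝓝 (a k))) (hl : Tendsto a atTop (𝓝 l))
    (hb : ∀ n, Tendsto (fun k => ψ k (v n)) atTop (𝓝 (b n))) : Tendsto b atTop (𝓝 l) := by
  obtain ⟨ψ', hψ'⟩ := exists_forall_tendsto_ultrafilter (hyperfilter ℕ) ψ C hψ
  have hle : (hyperfilter ℕ : Filter ℕ) ≤ atTop := Nat.hyperfilter_le_atTop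
  have hbψ : ∀ n, ψ' (v n) = b n := fun n =>
    tendsto_nhds_unique (hψ' (v n)) ((hb n).mono_left hle)
  rw [tendsto_iff_ultrafilter]
  intro U hU
  obtain ⟨Φ, hΦ⟩ := exists_forall_tendsto_ultrafilter U
    (fun n => NormedSpace.inclusionInDoubleDual ℝ V (v n)) C
    (fun n => (NormedSpace.double_dual_bound ℝ V (v n)).trans (hv n))
  obtain ⟨w, rfl⟩ := hV Φ
  have haw : ∀ k, ψ k w = a k := fun k => tendsto_nhds_unique (hΦ (ψ k)) ((ha k).mono_left hU)
  have h1 : ψ' w = l := by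
    refine tendsto_nhds_unique (hψ' w) ?_
    simpa only [haw] using hl.mono_left hle
  have h2 : Tendsto (fun n => ψ' (v n)) U (𝓝 (ψ' w)) := hΦ ψ'
  rw [h1] at h2
  simpa only [hbψ] using h2

/-- A sequence of numbers is interpolated on a sequence of vectors by a functional of norm at most
`g` as soon as the corresponding estimate holds for all rational combinations. -/
theorem exists_strongDual_apply_eq {V : Type*} [NormedAddCommGroup V] [NormedSpace ℝ V]
    (v : ℕ → V) (h : ℕ → ℝ) (g : ℝ)
    (hle : ∀ c : ℕ →₀ ℚ, |c.sum fun n r => (r : ℝ) * h n| ≤ g * ‖c.sum fun n r => (r : ℝ) • v n‖) :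
    ∃ ψ : StrongDual ℝ V, ‖ψ‖ ≤ max g 0 ∧ ∀ n, ψ (v n) = h n := by
  classical
  set T := Finsupp.linearCombination ℝ v with hT
  set S := Finsupp.linearCombination ℝ h with hS
  -- The estimate passes to real combinations by density.
  have hreal : ∀ c : ℕ →₀ ℝ, |S c| ≤ g * ‖T c‖ := by
    intro c
    have key : ∀ d : ℕ → ℝ, |∑ n ∈ c.support, d n * h n| ≤ g * ‖∑ n ∈ c.support, d n • v n‖ := by
      have hdense : DenseRange (fun (e : ℕ → ℚ) (n : ℕ) => (e n : ℝ)) :=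
        DenseRange.piMap (fun _ => Rat.denseRange_cast)
      intro d
      refine hdense.induction_on (p := fun d : ℕ → ℝ => |∑ n ∈ c.support, d n * h n| ≤
        g * ‖∑ n ∈ c.support, d n • v n‖) d ?_ ?_
      · exact isClosed_le (by fun_prop) (by fun_prop)
      · intro e
        have := hle (∑ n ∈ c.support, Finsupp.single n (e n))
        rw [← Finsupp.sum_finsetSum_index (by simp) (by intros; push_cast; ring),
          ← Finsupp.sum_finsetSum_index (by simp) (by intros; push_cast; rw [add_smul])] at this
        simpa [Finsupp.sum_single_index] using this
    simpa [hT, hS, Finsupp.linearCombination_apply, Finsupp.sum] using key c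
  obtain ⟨s, hs⟩ := T.rangeRestrict.exists_rightInverse_of_surjective
    (LinearMap.range_rangeRestrict _)
  have hTs : ∀ y : LinearMap.range T, T (s y) = y := fun y =>
    congrArg Subtype.val (LinearMap.congr_fun hs y)
  set ψ₀ : StrongDual ℝ (LinearMap.range T) :=
    LinearMap.mkContinuous (S ∘ₗ s) (max g 0) (fun y => by
      rw [LinearMap.comp_apply, Real.norm_eq_abs]
      refine (hreal (s y)).trans ?_
      rw [hTs y]
      gcongr
      · exact le_max_left _ _
      · exact le_rfl) with hψ₀
  obtain ⟨ψ, hψ, hψn⟩ := exists_extension_norm_eq (LinearMap.range T) ψ₀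
  refine ⟨ψ, hψn ▸ LinearMap.mkContinuous_norm_le _ (le_max_right _ _) _, fun n => ?_⟩
  have hmem : v n ∈ LinearMap.range T := ⟨Finsupp.single n 1, by simp [hT]⟩
  have h1 := hψ ⟨v n, hmem⟩
  have h2 : ψ₀ ⟨v n, hmem⟩ = S (s ⟨v n, hmem⟩) := rfl
  rw [h2] at h1
  have h3 : S (s ⟨v n, hmem⟩ - Finsupp.single n 1) = 0 := by
    have := hreal (s ⟨v n, hmem⟩ - Finsupp.single n 1)
    rw [map_sub T, hTs] at this
    simpa [hT] using this
  rw [map_sub, sub_eq_zero] at h3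
  rw [show ψ (v n) = _ from h1, h3]
  simp [hS]

/-! ### Tails of convex combinations -/

/-- Convex combinations of the image of a sequence under a linear map are images of convex
combinations. -/
theorem exists_mem_convexHull_map_eq {V W ι : Type*} [AddCommGroup V] [Module ℝ V]
    [AddCommGroup W] [Module ℝ W] (T : V →ₗ[ℝ] W) (u : ι → V) (s : Set ι) {w : W}
    (hw : w ∈ convexHull ℝ ((fun i => T (u i)) '' s)) : ∃ v ∈ convexHull ℝ (u '' s), T v = w := by
  rw [← Set.image_image T u s, ← T.image_convexHull] at hw
  exact hw

/-- A convex property of all terms of a sequence from `n` on passes to their convex combinations. -/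
theorem Convex.mem_of_mem_convexHull_tail {V : Type*} [AddCommGroup V] [Module ℝ V] {S : Set V}
    (hS : Convex ℝ S) {u : ℕ → V} {n : ℕ} (hu : ∀ i, n ≤ i → u i ∈ S) {v : V}
    (hv : v ∈ convexHull ℝ (u '' Set.Ici n)) : v ∈ S :=
  convexHull_min (Set.image_subset_iff.2 fun i hi => hu i hi) hS hv

theorem convexHull_tail_anti {V : Type*} [AddCommGroup V] [Module ℝ V] {u : ℕ → V} {m n : ℕ}
    (h : m ≤ n) : convexHull ℝ (u '' Set.Ici n) ⊆ convexHull ℝ (u '' Set.Ici m) :=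
  convexHull_mono (Set.image_mono (Set.Ici_subset_Ici.2 h))

theorem convexHull_tail_subset {V : Type*} [AddCommGroup V] [Module ℝ V] {u w : ℕ → V}
    (h : ∀ n, w n ∈ convexHull ℝ (u '' Set.Ici n)) (n : ℕ) :
    convexHull ℝ (w '' Set.Ici n) ⊆ convexHull ℝ (u '' Set.Ici n) := by
  refine convexHull_min ?_ (convex_convexHull ℝ _)
  rintro _ ⟨i, hi, rfl⟩
  exact convexHull_tail_anti hi (h i)

/-! ### Convex combinations of bounded sequences in Lebesgue spaces -/

/-- Strict convexity of `t ↦ |t| ^ r` on the whole line, at midpoints. -/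
theorem rpow_abs_midpoint_lt {r : ℝ} (hr : 1 < r) {a b : ℝ} (hab : a ≠ b) :
    |(a + b) / 2| ^ r < (|a| ^ r + |b| ^ r) / 2 := by
  have hr0 : 0 < r := by linarith
  by_cases h : |a| = |b|
  · have hba : b = -a := by
      rcases abs_eq_abs.1 h with h | h
      · exact absurd h hab
      · linarith
    have ha : a ≠ 0 := by
      rintro rfl
      exact hab (by simp [hba])
    have : 0 < |a| ^ r := Real.rpow_pos_of_pos (abs_pos.2 ha) r
    simp [hba, Real.zero_rpow hr0.ne', this]
  · have h1 := (strictConvexOn_rpow hr).2 (abs_nonneg a) (abs_nonneg b) h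
      (by norm_num : (0 : ℝ) < 1 / 2) (by norm_num : (0 : ℝ) < 1 / 2) (by norm_num)
    have h2 : |(a + b) / 2| ≤ 1 / 2 * |a| + 1 / 2 * |b| := by
      rw [abs_div, abs_two]
      linarith [abs_add_le a b]
    calc |(a + b) / 2| ^ r ≤ (1 / 2 * |a| + 1 / 2 * |b|) ^ r :=
          Real.rpow_le_rpow (abs_nonneg _) h2 hr0.le
      _ < 1 / 2 * |a| ^ r + 1 / 2 * |b| ^ r := by simpa using h1
      _ = _ := by ring

/-- A quantitative form of the strict convexity of `t ↦ |t| ^ r`, by compactness of the unit sphere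
of `ℝ × ℝ` and homogeneity. -/
theorem exists_abs_sub_rpow_le {r : ℝ} (hr : 1 < r) {ε : ℝ} (hε : 0 < ε) :
    ∃ C : ℝ, 0 ≤ C ∧ ∀ a b : ℝ, |a - b| ^ r ≤
      ε * (|a| ^ r + |b| ^ r) + C * ((|a| ^ r + |b| ^ r) / 2 - |(a + b) / 2| ^ r) := by
  have hr0 : 0 < r := by linarith
  have hcont : ∀ f : ℝ × ℝ → ℝ, Continuous f → Continuous fun z => |f z| ^ r := fun f hf =>
    (hf.abs).rpow_const fun _ => Or.inr hr0.le
  set D : ℝ × ℝ → ℝ := fun z => (|z.1| ^ r + |z.2| ^ r) / 2 - |(z.1 + z.2) / 2| ^ r with hD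
  set φ : ℝ × ℝ → ℝ := fun z => |z.1 - z.2| ^ r - ε * (|z.1| ^ r + |z.2| ^ r) with hφ
  have h1 := hcont _ continuous_fst
  have h2 := hcont _ continuous_snd
  have hDc : Continuous D := ((h1.add h2).div_const 2).sub (hcont _ (by fun_prop))
  have hφc : Continuous φ := (hcont _ (by fun_prop)).sub (continuous_const.mul (h1.add h2))
  have hD0 : ∀ z, 0 ≤ D z := by
    intro z
    by_cases h : z.1 = z.2
    · simp [hD, h]
    · exact (sub_pos.2 (rpow_abs_midpoint_lt hr h)).le
  -- It suffices to bound `φ` by a multiple of `D` on the unit sphere.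
  obtain ⟨C, hC0, hC⟩ : ∃ C : ℝ, 0 ≤ C ∧ ∀ z ∈ Metric.sphere (0 : ℝ × ℝ) 1, φ z ≤ C * D z := by
    have hSc : IsCompact (Metric.sphere (0 : ℝ × ℝ) 1) := isCompact_sphere _ _
    have hcomp : IsCompact (Metric.sphere (0 : ℝ × ℝ) 1 ∩ {z | 0 ≤ φ z}) :=
      hSc.inter_right (isClosed_le continuous_const hφc)
    have hpos : ∀ z ∈ Metric.sphere (0 : ℝ × ℝ) 1 ∩ {z | 0 ≤ φ z}, 0 < D z := by
      rintro z ⟨hz, hz'⟩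
      refine sub_pos.2 (rpow_abs_midpoint_lt hr fun h => ?_)
      have hz0 : z.1 ≠ 0 := by
        intro h0
        have : z = 0 := Prod.ext h0 (h ▸ h0)
        simp [this] at hz
      have h3 : 0 < |z.1| ^ r := Real.rpow_pos_of_pos (abs_pos.2 hz0) r
      have h4 : (0 : ℝ) ≤ φ z := hz'
      simp only [hφ, ← h, sub_self, abs_zero, Real.zero_rpow hr0.ne'] at h4
      nlinarith
    obtain ⟨M, hM⟩ := hSc.bddAbove_image hφc.continuousOn
    rcases (Metric.sphere (0 : ℝ × ℝ) 1 ∩ {z | 0 ≤ φ z}).eq_empty_or_nonempty with he | hne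
    · refine ⟨0, le_rfl, fun z hz => ?_⟩
      by_contra hlt
      have : z ∈ Metric.sphere (0 : ℝ × ℝ) 1 ∩ {z | 0 ≤ φ z} := ⟨hz, by
        simp only [zero_mul, not_le] at hlt
        exact hlt.le⟩
      rw [he] at this
      exact this
    · obtain ⟨w, hw, hmin⟩ := hcomp.exists_isMinOn hne hDc.continuousOn
      have hδ := hpos w hw
      refine ⟨|M| / D w, by positivity, fun z hz => ?_⟩
      by_cases h : 0 ≤ φ z
      · have h3 : D w ≤ D z := hmin ⟨hz, h⟩
        have h4 : φ z ≤ M := hM ⟨z, hz, rfl⟩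
        calc φ z ≤ |M| := h4.trans (le_abs_self M)
          _ = |M| / D w * D w := by field_simp
          _ ≤ |M| / D w * D z := by gcongr
      · exact (not_le.1 h).le.trans (mul_nonneg (by positivity) (hD0 z))
  refine ⟨C, hC0, fun a b => ?_⟩
  rcases eq_or_ne ((a, b) : ℝ × ℝ) 0 with h0 | h0
  · obtain ⟨rfl, rfl⟩ := Prod.mk_eq_zero.1 h0
    simp [Real.zero_rpow hr0.ne']
  · have ht : 0 < ‖((a, b) : ℝ × ℝ)‖ := norm_pos_iff.2 h0
    set t := ‖((a, b) : ℝ × ℝ)‖ with htd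
    have hz : ((a / t, b / t) : ℝ × ℝ) ∈ Metric.sphere (0 : ℝ × ℝ) 1 := by
      have : ((a / t, b / t) : ℝ × ℝ) = t⁻¹ • ((a, b) : ℝ × ℝ) := by
        simp [div_eq_inv_mul]
      rw [mem_sphere_zero_iff_norm, this, norm_smul, norm_inv, norm_norm, inv_mul_cancel₀ ht.ne']
    have hs : ∀ c : ℝ, |c| ^ r = t ^ r * |c / t| ^ r := by
      intro c
      rw [abs_div, abs_of_pos ht, ← Real.mul_rpow ht.le (by positivity), mul_div_cancel₀ _ ht.ne']
    have h3 := hC _ hz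
    simp only [hφ, hD] at h3
    rw [← sub_div, ← add_div, div_right_comm] at h3
    rw [hs a, hs b, hs (a - b), hs ((a + b) / 2)]
    have h4 : 0 < t ^ r := Real.rpow_pos_of_pos ht r
    nlinarith [mul_le_mul_of_nonneg_left h3 h4.le]

/-- The `p`-th power of the norm of `L^p` as an integral. -/
theorem norm_rpow_eq_integral {Y F : Type*} [MeasurableSpace Y] {ν : Measure Y}
    [NormedAddCommGroup F] {p : ℝ≥0∞} [Fact (1 ≤ p)] (hp : p ≠ ∞) (f : Lp F p ν) :
    ‖f‖ ^ p.toReal = ∫ y, ‖f y‖ ^ p.toReal ∂ν := by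
  have hp0 : p ≠ 0 := (zero_lt_one.trans_le Fact.out).ne'
  have hr0 : 0 < p.toReal := ENNReal.toReal_pos hp0 hp
  have h0 : 0 ≤ ∫ y, ‖f y‖ ^ p.toReal ∂ν := integral_nonneg fun y => by positivity
  rw [Lp.norm_def, (Lp.memLp f).eLpNorm_eq_integral_rpow_norm hp0 hp,
    ENNReal.toReal_ofReal (by positivity), ← Real.rpow_mul h0, inv_mul_cancel₀ hr0.ne',
    Real.rpow_one]

/-- In `L^p`, `1 < p < ∞`, two functions of almost the same norm as their midpoint are close. -/
theorem norm_sub_rpow_le_of_midpoint {Y : Type*} [MeasurableSpace Y] {ν : Measure Y}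
    {p : ℝ≥0∞} [Fact (1 ≤ p)] (hp' : p ≠ ∞) {ε C : ℝ}
    (hC : ∀ a b : ℝ, |a - b| ^ p.toReal ≤ ε * (|a| ^ p.toReal + |b| ^ p.toReal) +
      C * ((|a| ^ p.toReal + |b| ^ p.toReal) / 2 - |(a + b) / 2| ^ p.toReal)) (f g : Lp ℝ p ν) :
    ‖f - g‖ ^ p.toReal ≤ ε * (‖f‖ ^ p.toReal + ‖g‖ ^ p.toReal) +
      C * ((‖f‖ ^ p.toReal + ‖g‖ ^ p.toReal) / 2 - ‖(2⁻¹ : ℝ) • (f + g)‖ ^ p.toReal) := by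
  have hp0 : p ≠ 0 := (zero_lt_one.trans_le Fact.out).ne'
  have hi : ∀ h : Lp ℝ p ν, Integrable (fun y => ‖h y‖ ^ p.toReal) ν := fun h =>
    (Lp.memLp h).integrable_norm_rpow hp0 hp'
  have e : ε * (‖f‖ ^ p.toReal + ‖g‖ ^ p.toReal) +
      C * ((‖f‖ ^ p.toReal + ‖g‖ ^ p.toReal) / 2 - ‖(2⁻¹ : ℝ) • (f + g)‖ ^ p.toReal) =
      ∫ y, ε * (‖f y‖ ^ p.toReal + ‖g y‖ ^ p.toReal) + C * ((‖f y‖ ^ p.toReal +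
        ‖g y‖ ^ p.toReal) / 2 - ‖((2⁻¹ : ℝ) • (f + g) : Lp ℝ p ν) y‖ ^ p.toReal) ∂ν := by
    rw [integral_add, integral_const_mul, integral_const_mul, integral_sub, integral_div,
      integral_add (hi f) (hi g)]
    · simp only [norm_rpow_eq_integral hp']
    · exact ((hi f).add (hi g)).div_const 2
    · exact hi _
    · exact ((hi f).add (hi g)).const_mul ε
    · exact ((((hi f).add (hi g)).div_const 2).sub (hi _)).const_mul C
  rw [e, norm_rpow_eq_integral hp']
  refine integral_mono_ae (hi _) ?_ ?_
  · exact (((hi f).add (hi g)).const_mul ε).add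
      (((((hi f).add (hi g)).div_const 2).sub (hi _)).const_mul C)
  · filter_upwards [Lp.coeFn_sub f g, Lp.coeFn_add f g, Lp.coeFn_smul (2⁻¹ : ℝ) (f + g)]
      with y h1 h2 h3
    simp only [h1, h3, Pi.smul_apply, h2, Pi.sub_apply, Pi.add_apply, smul_eq_mul, Real.norm_eq_abs]
    have := hC (f y) (g y)
    rwa [div_eq_inv_mul (f y + g y)] at this

/-- A bounded sequence in `L^p`, `1 < p < ∞`, has tails of convex combinations which form a Cauchy
sequence: it suffices to take combinations of almost minimal norm. -/
theorem exists_cauchySeq_convexHull_tail {Y : Type*} [MeasurableSpace Y] {ν : Measure Y}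
    {p : ℝ≥0∞} [Fact (1 ≤ p)] (hp : 1 < p) (hp' : p ≠ ∞) (u : ℕ → Lp ℝ p ν) (K : ℝ)
    (hu : ∀ n, ‖u n‖ ≤ K) :
    ∃ z : ℕ → Lp ℝ p ν, (∀ n, z n ∈ convexHull ℝ (u '' Set.Ici n)) ∧ CauchySeq z := by
  set r := p.toReal with hrd
  have hr : 1 < r := by
    rw [hrd, ← ENNReal.toReal_one]
    exact (ENNReal.toReal_lt_toReal ENNReal.one_ne_top hp').2 hp
  have hr0 : 0 < r := by linarith
  have hK : 0 ≤ K := (norm_nonneg _).trans (hu 0)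
  set A : ℕ → Set (Lp ℝ p ν) := fun n => convexHull ℝ (u '' Set.Ici n) with hA
  have hAne : ∀ n, (A n).Nonempty := fun n => ⟨u n, subset_convexHull _ _ ⟨n, Set.self_mem_Ici, rfl⟩⟩
  have hAanti : ∀ m n, m ≤ n → A n ⊆ A m := fun m n h =>
    convexHull_tail_anti h
  have hAK : ∀ n, ∀ z ∈ A n, ‖z‖ ^ r ≤ K ^ r := by
    intro n z hz
    have h1 : z ∈ Metric.closedBall (0 : Lp ℝ p ν) K :=
      (convex_closedBall _ _).mem_of_mem_convexHull_tail (fun i _ => by simpa using hu i) hz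
    exact Real.rpow_le_rpow (norm_nonneg _) (by simpa using h1) hr0.le
  -- The minimal values of the norm on the tails increase to a limit.
  set I : ℕ → ℝ := fun n => sInf ((fun z => ‖z‖ ^ r) '' A n) with hI
  have hbdd : ∀ n, BddBelow ((fun z : Lp ℝ p ν => ‖z‖ ^ r) '' A n) := fun n =>
    ⟨0, by rintro _ ⟨z, -, rfl⟩; positivity⟩
  have hIle : ∀ n, ∀ z ∈ A n, I n ≤ ‖z‖ ^ r := fun n z hz => csInf_le (hbdd n) ⟨z, hz, rfl⟩
  have hImono : Monotone I := fun m n h =>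
    csInf_le_csInf (hbdd m) ((hAne n).image _) (Set.image_mono (hAanti m n h))
  have hIK : BddAbove (Set.range I) := by
    refine ⟨K ^ r, ?_⟩
    rintro _ ⟨n, rfl⟩
    obtain ⟨z, hz⟩ := hAne n
    exact (hIle n z hz).trans (hAK n z hz)
  have hIcauchy : CauchySeq I := (tendsto_atTop_ciSup hImono hIK).cauchySeq
  have hex : ∀ n : ℕ, ∃ z ∈ A n, ‖z‖ ^ r < I n + 1 / ((n : ℝ) + 1) := by
    intro n
    obtain ⟨_, ⟨z, hz, rfl⟩, h⟩ := exists_lt_of_csInf_lt ((hAne n).image fun z => ‖z‖ ^ r)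
      (lt_add_of_pos_right (I n) (Nat.one_div_pos_of_nat (n := n)))
    exact ⟨z, hz, h⟩
  choose z hzA hzI using hex
  refine ⟨z, hzA, ?_⟩
  rw [Metric.cauchySeq_iff']
  intro η hη
  have hηr : 0 < η ^ r := Real.rpow_pos_of_pos hη r
  set ε := η ^ r / (4 * (K ^ r + 1)) with hεd
  have hKr : 0 ≤ K ^ r := Real.rpow_nonneg hK r
  have hε : 0 < ε := by positivity
  obtain ⟨C, hC0, hC⟩ := exists_abs_sub_rpow_le hr hε
  obtain ⟨δ, hδd⟩ : ∃ δ, δ = η ^ r / (8 * (C + 1)) := ⟨_, rfl⟩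
  have hδ : 0 < δ := by rw [hδd]; positivity
  obtain ⟨N₁, hN₁⟩ := Metric.cauchySeq_iff'.1 hIcauchy (δ) hδ
  obtain ⟨N₂, hN₂⟩ := exists_nat_one_div_lt (K := ℝ) (ε := δ) hδ
  refine ⟨max N₁ N₂, fun n hn => ?_⟩
  set m := max N₁ N₂ with hm
  have hn1 : N₁ ≤ n := (le_max_left _ _).trans hn
  have hI1 : |I n - I N₁| < δ := hN₁ n hn1
  have hInm : I n - I m < δ := by
    have := hImono (le_max_left N₁ N₂)
    linarith [(abs_lt.1 hI1).2]
  have hfrac : ∀ j, N₂ ≤ j → 1 / ((j : ℝ) + 1) < δ := fun j hj =>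
    lt_of_le_of_lt (one_div_le_one_div_of_le (by positivity) (by gcongr)) hN₂
  have h1 := hfrac m (le_max_right _ _)
  have h2 := hfrac n ((le_max_right _ _).trans hn)
  have hmid : I m ≤ ‖(2⁻¹ : ℝ) • (z n + z m)‖ ^ r := by
    refine hIle m _ ?_
    rw [smul_add]
    exact (convex_convexHull ℝ _) (hAanti m n hn (hzA n)) (hzA m) (by norm_num) (by norm_num)
      (by norm_num)
  have h3 := norm_sub_rpow_le_of_midpoint hp' hC (z n) (z m)
  have h4 : (‖z n‖ ^ r + ‖z m‖ ^ r) / 2 - ‖(2⁻¹ : ℝ) • (z n + z m)‖ ^ r ≤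
      2 * δ := by
    have h5 := hzI n
    have h6 := hzI m
    linarith
  have h5 : ‖z n - z m‖ ^ r < η ^ r := by
    have h6 : ε * (‖z n‖ ^ r + ‖z m‖ ^ r) ≤ η ^ r / 2 := by
      calc ε * (‖z n‖ ^ r + ‖z m‖ ^ r) ≤ ε * (2 * (K ^ r + 1)) := by
            gcongr
            linarith [hAK n _ (hzA n), hAK m _ (hzA m)]
        _ = η ^ r / 2 := by rw [hεd]; field_simp; norm_num
    have h7 : C * (2 * δ) ≤ η ^ r / 4 := by
      rw [show C * (2 * δ) = η ^ r / 4 * (C / (C + 1)) by rw [hδd]; field_simp; ring]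
      exact mul_le_of_le_one_right (by positivity) ((div_le_one (by positivity)).2 (by linarith))
    have h8 := mul_le_mul_of_nonneg_left h4 hC0
    linarith
  rw [dist_eq_norm]
  exact (Real.rpow_lt_rpow_iff (norm_nonneg _) hη.le hr0).1 h5

/-- A Cauchy sequence in `L^p` has a subsequence which is dominated by a function in `L^p` and
converges almost everywhere. -/
theorem exists_subseq_dominated_of_cauchySeq {Y : Type*} [MeasurableSpace Y] {ν : Measure Y}
    {p : ℝ≥0∞} [Fact (1 ≤ p)] (z : ℕ → Lp ℝ p ν) (hz : CauchySeq z) :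
    ∃ m : ℕ → ℕ, StrictMono m ∧ ∃ G : Lp ℝ p ν, (∀ n, ∀ᵐ y ∂ν, |z (m n) y| ≤ G y) ∧
      ∀ᵐ y ∂ν, ∃ l, Tendsto (fun n => z (m n) y) atTop (𝓝 l) := by
  obtain ⟨m, hm, hmz⟩ : ∃ m : ℕ → ℕ, StrictMono m ∧
      ∀ n, ∀ k ≥ m n, dist (z k) (z (m n)) < (1 / 2 : ℝ) ^ n := by
    refine extraction_forall_of_eventually' (P := fun n j => ∀ k ≥ j, dist (z k) (z j) <
      (1 / 2 : ℝ) ^ n) fun n => ?_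
    obtain ⟨N, hN⟩ := Metric.cauchySeq_iff.1 hz ((1 / 2 : ℝ) ^ n) (by positivity)
    exact ⟨N, fun j hj k hk => hN k (hj.trans hk) j hj⟩
  refine ⟨m, hm, ?_⟩
  set y : ℕ → Lp ℝ p ν := fun n => z (m n) with hy
  set D : ℕ → Lp ℝ p ν := fun n => |y (n + 1) - y n| with hD
  have hDn : ∀ n, ‖y (n + 1) - y n‖ ≤ (1 / 2 : ℝ) ^ n := fun n => by
    rw [← dist_eq_norm]
    exact (hmz n _ (hm.monotone n.le_succ)).le
  have hgeo : Summable fun n : ℕ => (1 / 2 : ℝ) ^ n := summable_geometric_two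
  have hsum : Summable fun n => ‖y (n + 1) - y n‖ :=
    Summable.of_nonneg_of_le (fun n => norm_nonneg _) hDn hgeo
  have hDs : Summable D := Summable.of_norm (by simpa only [hD, norm_abs_eq_norm] using hsum)
  have hsub : ∀ n, y n = y 0 + ∑ j ∈ Finset.range n, (y (j + 1) - y j) := fun n => by
    rw [Finset.sum_range_sub]
    abel
  refine ⟨|y 0| + ∑' n, D n, fun n => ?_, ?_⟩
  · have hle : |y n| ≤ |y 0| + ∑' n, D n := by
      have h1 : ∑ j ∈ Finset.range n, D j ≤ ∑' n, D n :=
        hDs.sum_le_tsum _ fun j _ => abs_nonneg _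
      have h2 : |∑ j ∈ Finset.range n, (y (j + 1) - y j)| ≤ ∑ j ∈ Finset.range n, D j :=
        Finset.le_sum_of_subadditive (fun w : Lp ℝ p ν => |w|) abs_zero.le abs_add_le _ _
      rw [hsub n]
      exact (abs_add_le _ _).trans (add_le_add le_rfl (h2.trans h1))
    filter_upwards [(Lp.coeFn_le _ _).2 hle, Lp.coeFn_abs (y n)] with x h1 h2
    rwa [h2] at h1
  · have hfin : ∑' n, ‖y (n + 1) - y n‖ₑ ≠ ∞ := by
      exact tsum_enorm_ne_top_iff_summable_norm.2 hsum
    filter_upwards [Lp.hasSum_coeFn_tsum hfin,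
      ae_all_iff.2 fun n => Lp.coeFn_sub (y (n + 1)) (y n)] with x h1 h2
    simp only [h2, Pi.sub_apply] at h1
    have h3 := h1.tendsto_sum_nat
    simp only [Finset.sum_range_sub (fun n => y n x)] at h3
    exact ⟨_, by simpa using h3.add_const (y 0 x)⟩

/-- A sequence of functions which is bounded in `L^p`, `1 < p < ∞`, has tails of convex combinations
which are dominated by a single function in `L^p` and converge almost everywhere. -/
theorem exists_convexHull_tail_dominated {Y : Type*} [MeasurableSpace Y] {ν : Measure Y}
    {p : ℝ≥0∞} (hp : 1 < p) (hp' : p ≠ ∞) (a : ℕ → Y → ℝ) (ha : ∀ n, MemLp (a n) p ν) (K : ℝ)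
    (hK : ∀ n, eLpNorm (a n) p ν ≤ ENNReal.ofReal K) :
    ∃ b : ℕ → Y → ℝ, (∀ n, b n ∈ convexHull ℝ (a '' Set.Ici n)) ∧
      (∃ G : Y → ℝ, MemLp G p ν ∧ ∀ n, ∀ᵐ y ∂ν, |b n y| ≤ G y) ∧
      ∀ᵐ y ∂ν, ∃ l, Tendsto (fun n => b n y) atTop (𝓝 l) := by
  have : Fact (1 ≤ p) := ⟨hp.le⟩
  set u : ℕ → Lp ℝ p ν := fun n => (ha n).toLp with hu
  have hun : ∀ n, ‖u n‖ ≤ max K 0 := fun n => by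
    rw [hu, Lp.norm_toLp]
    refine ENNReal.toReal_le_of_le_ofReal (le_max_right _ _) ((hK n).trans ?_)
    exact ENNReal.ofReal_le_ofReal (le_max_left _ _)
  obtain ⟨z, hz, hzc⟩ := exists_cauchySeq_convexHull_tail hp hp' u _ hun
  obtain ⟨m, hm, G, hG, hl⟩ := exists_subseq_dominated_of_cauchySeq z hzc
  -- Convex combinations of classes are lifted to convex combinations of functions.
  have hlift : ∀ n, ∃ b ∈ convexHull ℝ (a '' Set.Ici n), z (m n) =ᵐ[ν] b := by
    intro n
    have hmem : z (m n) ∈ convexHull ℝ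
        ((fun i => LinearMap.snd ℝ (Y → ℝ) (Lp ℝ p ν) (a i, u i)) '' Set.Ici n) :=
      convexHull_tail_anti hm.le_apply (hz (m n))
    obtain ⟨w, hw, hwz⟩ := exists_mem_convexHull_map_eq _ _ _ hmem
    have h1 : w.1 ∈ convexHull ℝ (a '' Set.Ici n) := by
      have := Set.mem_image_of_mem (LinearMap.fst ℝ (Y → ℝ) (Lp ℝ p ν)) hw
      rw [LinearMap.image_convexHull, Set.image_image] at this
      exact this
    have hconv : Convex ℝ {w : (Y → ℝ) × Lp ℝ p ν | w.2 =ᵐ[ν] w.1} := by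
      intro w₁ h₁ w₂ h₂ s t _ _ _
      show ((s • w₁.2 + t • w₂.2 : Lp ℝ p ν) : Y → ℝ) =ᵐ[ν] s • w₁.1 + t • w₂.1
      filter_upwards [Lp.coeFn_add (s • w₁.2) (t • w₂.2), Lp.coeFn_smul s w₁.2,
        Lp.coeFn_smul t w₂.2, h₁, h₂] with y e1 e2 e3 e4 e5
      rw [e1, Pi.add_apply, e2, e3, Pi.smul_apply, Pi.smul_apply, e4, e5]
      rfl
    have h2 : w.2 =ᵐ[ν] w.1 :=
      hconv.mem_of_mem_convexHull_tail (fun i _ => (ha i).coeFn_toLp) hw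
    exact ⟨w.1, h1, by rw [← hwz]; exact h2⟩
  choose b hb hzb using hlift
  refine ⟨b, hb, ⟨G, Lp.memLp G, fun n => ?_⟩, ?_⟩
  · filter_upwards [hG n, hzb n] with y h1 h2
    rwa [← h2]
  · filter_upwards [hl, ae_all_iff.2 hzb] with y h1 h2
    simpa only [← h2] using h1

/-- A sequence of functions on an s-finite measure space which is bounded at almost every point has tails of
convex combinations which converge almost everywhere. -/
theorem exists_convexHull_tail_tendsto {Y : Type*} [MeasurableSpace Y] {ν : Measure Y}
    [SFinite ν] (F : ℕ → Y → ℝ) (hF : ∀ n, AEMeasurable (F n) ν) (W : Y → ℝ)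
    (hW : AEMeasurable W ν) (hFW : ∀ n, ∀ᵐ y ∂ν, |F n y| ≤ W y) :
    ∃ G : ℕ → Y → ℝ, (∀ n, G n ∈ convexHull ℝ (F '' Set.Ici n)) ∧
      ∀ᵐ y ∂ν, ∃ l, Tendsto (fun n => G n y) atTop (𝓝 l) := by
  set ρ := ν.toFinite with hρ
  have hac : ρ ≪ ν := toFinite_absolutelyContinuous ν
  -- The normalised sequence is bounded in `L²` of an equivalent finite measure.
  set T : (Y → ℝ) →ₗ[ℝ] (Y → ℝ) := LinearMap.mulLeft ℝ (fun y => (1 + |W y|)⁻¹) with hT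
  have hb : ∀ n, ∀ᵐ y ∂ρ, ‖T (F n) y‖ ≤ 1 := fun n => by
    filter_upwards [hac (hFW n)] with y hy
    have h0 : 0 < 1 + |W y| := by positivity
    simp only [hT, LinearMap.mulLeft_apply, Pi.mul_apply, norm_mul, norm_inv, Real.norm_eq_abs,
      abs_of_pos h0]
    rw [inv_mul_le_one₀ h0]
    linarith [le_abs_self (W y)]
  have hm : ∀ n, AEStronglyMeasurable (T (F n)) ρ := fun n =>
    ((((hW.mono_ac hac).abs.const_add 1).inv).mul ((hF n).mono_ac hac)).aestronglyMeasurable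
  have hLp : ∀ n, MemLp (T (F n)) 2 ρ := fun n => MemLp.of_bound (hm n) 1 (hb n)
  obtain ⟨b, hbc, -, hl⟩ := exists_convexHull_tail_dominated (by norm_num) (by norm_num)
    (fun n => T (F n)) hLp (ρ Set.univ ^ (2 : ℝ≥0∞).toReal⁻¹ * ENNReal.ofReal 1).toReal (by
      intro n
      rw [ENNReal.ofReal_toReal]
      · exact eLpNorm_le_of_ae_bound (hb n)
      · finiteness)
  choose G hG hGb using fun n => exists_mem_convexHull_map_eq T F (Set.Ici n) (hbc n)
  refine ⟨G, hG, ?_⟩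
  have hl' : ∀ᵐ y ∂ν, ∃ l, Tendsto (fun n => b n y) atTop (𝓝 l) :=
    (absolutelyContinuous_toFinite ν) hl
  filter_upwards [hl'] with y ⟨l, hl⟩
  have h0 : (1 + |W y|) ≠ 0 := by positivity
  refine ⟨(1 + |W y|) * l, (hl.const_mul (1 + |W y|)).congr fun n => ?_⟩
  rw [← hGb n]
  simp only [hT, LinearMap.mulLeft_apply, Pi.mul_apply]
  rw [mul_inv_cancel_left₀ h0]

/-- A version of `exists_convexHull_tail_tendsto` for countably many linear images of one sequence
at the same time. -/
theorem exists_convexHull_tail_forall_tendsto {X : Type*} [MeasurableSpace X] {μ : Measure X}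
    [SFinite μ] {V : Type*} [AddCommGroup V] [Module ℝ V] (u : ℕ → V) (T : ℕ → V →ₗ[ℝ] (X → ℝ))
    (hT : ∀ k n, AEMeasurable (T k (u n)) μ) (W : X → ℝ) (hW : AEMeasurable W μ)
    (hTW : ∀ k n, ∀ᵐ x ∂μ, |T k (u n) x| ≤ W x) :
    ∃ w : ℕ → V, (∀ n, w n ∈ convexHull ℝ (u '' Set.Ici n)) ∧
      ∀ᵐ x ∂μ, ∀ k, ∃ l, Tendsto (fun n => T k (w n) x) atTop (𝓝 l) := by
  -- The images are regarded as a single function on countably many copies of `X`.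
  have hι : ∀ k : ℕ, MeasurableEmbedding fun x : X => (x, k) := fun k =>
    MeasurableEmbedding.of_measurable_inverse (g := Prod.fst) (by fun_prop)
      (by
        have : Set.range (fun x : X => (x, k)) = Prod.snd ⁻¹' {k} := by
          ext ⟨x, j⟩
          simp [eq_comm]
        rw [this]
        exact measurable_snd (measurableSet_singleton k)) measurable_fst (fun x => rfl)
  set ν : Measure (X × ℕ) := Measure.sum fun k => μ.map fun x => (x, k) with hν
  have hae : ∀ P : X × ℕ → Prop, (∀ᵐ z ∂ν, P z) ↔ ∀ k, ∀ᵐ x ∂μ, P (x, k) := fun P => by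
    rw [hν, Measure.ae_sum_iff]
    exact forall_congr' fun k => (hι k).ae_map_iff
  have hmeas : ∀ f : X × ℕ → ℝ, (∀ k, AEMeasurable (fun x => f (x, k)) μ) → AEMeasurable f ν :=
    fun f hf => aemeasurable_sum_measure_iff.2 fun k => (hι k).aemeasurable_map_iff.2 (hf k)
  set S : V →ₗ[ℝ] (X × ℕ → ℝ) := LinearMap.pi fun z => LinearMap.proj z.1 ∘ₗ T z.2 with hS
  obtain ⟨G, hG, hGl⟩ := exists_convexHull_tail_tendsto (ν := ν) (fun n => S (u n))
    (fun n => hmeas _ fun k => hT k n) (fun z => W z.1) (hmeas _ fun k => hW)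
    (fun n => (hae _).2 fun k => hTW k n)
  choose w hw hwG using fun n => exists_mem_convexHull_map_eq S u (Set.Ici n) (hG n)
  refine ⟨w, hw, ae_all_iff.2 fun k => ?_⟩
  filter_upwards [(hae _).1 hGl k] with x ⟨l, hl⟩
  refine ⟨l, ?_⟩
  simp only [← hwG] at hl
  exact hl

/-- Vector-valued functions which are bounded by a bounded sequence in `L^p` have tails of convex
combinations which are dominated by a single function in `L^p`. -/
theorem exists_convexHull_tail_norm_le {X : Type*} [MeasurableSpace X] {μ : Measure X}
    {F : Type*} [NormedAddCommGroup F] [NormedSpace ℝ F]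
    {p : ℝ≥0∞} (hp : 1 < p) (hp' : p ≠ ∞) (u : ℕ → X → F) (g : ℕ → X → ℝ)
    (hug : ∀ n, ∀ᵐ x ∂μ, ‖u n x‖ ≤ g n x) (hg : ∀ n, MemLp (g n) p μ) (K : ℝ)
    (hK : ∀ n, eLpNorm (g n) p μ ≤ ENNReal.ofReal K) :
    ∃ w : ℕ → X → F, (∀ n, w n ∈ convexHull ℝ (u '' Set.Ici n)) ∧
      ∃ G : X → ℝ, MemLp G p μ ∧ ∀ n, ∀ᵐ x ∂μ, ‖w n x‖ ≤ G x := by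
  obtain ⟨b, hb, ⟨G, hG, hbG⟩, -⟩ := exists_convexHull_tail_dominated hp hp' g hg K hK
  choose w hw hwb using fun n => exists_mem_convexHull_map_eq
    (LinearMap.snd ℝ (X → F) (X → ℝ)) (fun i => (u i, g i)) (Set.Ici n) (hb n)
  refine ⟨fun n => (w n).1, fun n => ?_, G, hG, fun n => ?_⟩
  · have := Set.mem_image_of_mem (LinearMap.fst ℝ (X → F) (X → ℝ)) (hw n)
    rw [LinearMap.image_convexHull, Set.image_image] at this
    exact this
  · have hconv : Convex ℝ {w : (X → F) × (X → ℝ) | ∀ᵐ x ∂μ, ‖w.1 x‖ ≤ w.2 x} := by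
      intro w₁ h₁ w₂ h₂ s t hs ht _
      show ∀ᵐ x ∂μ, ‖s • w₁.1 x + t • w₂.1 x‖ ≤ s * w₁.2 x + t * w₂.2 x
      filter_upwards [h₁, h₂] with x e1 e2
      refine (norm_add_le _ _).trans ?_
      rw [norm_smul, norm_smul, Real.norm_of_nonneg hs, Real.norm_of_nonneg ht]
      gcongr
    have h1 : ∀ᵐ x ∂μ, ‖(w n).1 x‖ ≤ (w n).2 x :=
      hconv.mem_of_mem_convexHull_tail (fun i _ => hug i) (hw n)
    have h2 : (w n).2 = b n := hwb n
    filter_upwards [h1, hbG n] with x e1 e2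
    rw [h2] at e1
    exact e1.trans ((le_abs_self _).trans e2)

/-! ### The triangular pattern is impossible over reflexive fibers -/

/-- Bounded sequences of sections of a field of reflexive spaces and of functionals cannot be matched
in a triangular pattern. After passing to tails of convex combinations, which preserves the pattern,
both sequences are dominated and all pointwise limits exist; the iterated limits agree at almost
every point, and dominated convergence makes the iterated limits of the integrals agree. -/
theorem not_triangular_integral {X : Type*} [MeasurableSpace X] {μ : Measure X} [SFinite μ]
    {B : Type*} [NormedAddCommGroup B] [NormedSpace ℝ B] {p q : ℝ≥0∞} [p.HolderConjugate q]
    (hp : 1 < p) (hp' : p ≠ ∞) (hq : 1 < q) (hq' : q ≠ ∞)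
    (E : X → Submodule ℝ B) (hE : ∀ᵐ x ∂μ, IsReflexiveSpace (E x)) (K : ℝ)
    (v : ℕ → X → B) (hv : ∀ n, MemLp (v n) p μ) (hvE : ∀ n, ∀ᵐ x ∂μ, v n x ∈ E x)
    (hvK : ∀ n, eLpNorm (v n) p μ ≤ ENNReal.ofReal K)
    (ψ : ℕ → X → StrongDual ℝ B) (g : ℕ → X → ℝ) (hg : ∀ k, MemLp (g k) q μ)
    (hgK : ∀ k, eLpNorm (g k) q μ ≤ ENNReal.ofReal K) (hψg : ∀ k, ∀ᵐ x ∂μ, ‖ψ k x‖ ≤ g k x)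
    (hmeas : ∀ k n, AEMeasurable (fun x => ψ k x (v n x)) μ)
    (h1 : ∀ k n, k ≤ n → ∫ x, ψ k x (v n x) ∂μ = 1)
    (h0 : ∀ k n, n < k → ∫ x, ψ k x (v n x) ∂μ = 0) : False := by
  have hint₀ : ∀ k n, Integrable (fun x => ψ k x (v n x)) μ := by
    intro k n
    refine ((hg k).integrable_mul (q := p) (hv n).norm).mono (hmeas k n).aestronglyMeasurable ?_
    filter_upwards [hψg k] with x hx
    refine ((ψ k x).le_opNorm _).trans (le_trans ?_ (le_abs_self _))
    exact mul_le_mul_of_nonneg_right hx (norm_nonneg _)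
  -- The sets which the passage to convex combinations preserves.
  have hconvI : ∀ w : X → B, ∀ c : ℝ, Convex ℝ {φ : X → StrongDual ℝ B |
      Integrable (fun x => φ x (w x)) μ ∧ ∫ x, φ x (w x) ∂μ = c} := by
    rintro w c φ₁ ⟨i₁, e₁⟩ φ₂ ⟨i₂, e₂⟩ s t - - hst
    refine ⟨(i₁.const_mul s).add (i₂.const_mul t), ?_⟩
    have : ∀ x, (s • φ₁ + t • φ₂) x (w x) = s * φ₁ x (w x) + t * φ₂ x (w x) := fun x => rfl
    simp only [this]
    rw [integral_add (i₁.const_mul s) (i₂.const_mul t), integral_const_mul, integral_const_mul,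
      e₁, e₂, ← add_mul, hst, one_mul]
  have hconvI' : ∀ φ : X → StrongDual ℝ B, ∀ c : ℝ, Convex ℝ {w : X → B |
      Integrable (fun x => φ x (w x)) μ ∧ ∫ x, φ x (w x) ∂μ = c} := by
    rintro φ c w₁ ⟨i₁, e₁⟩ w₂ ⟨i₂, e₂⟩ s t - - hst
    have : ∀ x, φ x ((s • w₁ + t • w₂) x) = s * φ x (w₁ x) + t * φ x (w₂ x) := fun x => by
      simp
    simp only [Set.mem_ofPred_eq, this]
    refine ⟨(i₁.const_mul s).add (i₂.const_mul t), ?_⟩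
    rw [integral_add (i₁.const_mul s) (i₂.const_mul t), integral_const_mul, integral_const_mul,
      e₁, e₂, ← add_mul, hst, one_mul]
  have hint : ∀ φ ∈ convexHull ℝ (ψ '' Set.Ici 0), ∀ w ∈ convexHull ℝ (v '' Set.Ici 0),
      Integrable (fun x => φ x (w x)) μ := by
    intro φ hφ w hw
    have hc : Convex ℝ {φ : X → StrongDual ℝ B | Integrable (fun x => φ x (w x)) μ} := by
      intro φ₁ i₁ φ₂ i₂ s t _ _ _
      exact (Integrable.const_mul i₁ s).add (Integrable.const_mul i₂ t)
    refine hc.mem_of_mem_convexHull_tail (fun k _ => ?_) hφ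
    have hc' : Convex ℝ {w : X → B | Integrable (fun x => ψ k x (w x)) μ} := by
      intro w₁ i₁ w₂ i₂ s t _ _ _
      refine ((Integrable.const_mul i₁ s).add (Integrable.const_mul i₂ t)).congr ?_
      exact Eventually.of_forall fun x => by simp
    exact hc'.mem_of_mem_convexHull_tail (fun n _ => hint₀ k n) hw
  have hone : ∀ φ ∈ convexHull ℝ (ψ '' Set.Ici 0), ∀ᶠ n in atTop,
      ∀ w ∈ convexHull ℝ (v '' Set.Ici n),
        Integrable (fun x => φ x (w x)) μ ∧ ∫ x, φ x (w x) ∂μ = 1 := by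
    intro φ hφ
    have hc : Convex ℝ {φ : X → StrongDual ℝ B | ∀ᶠ n in atTop,
        ∀ w ∈ convexHull ℝ (v '' Set.Ici n),
          Integrable (fun x => φ x (w x)) μ ∧ ∫ x, φ x (w x) ∂μ = 1} := by
      intro φ₁ i₁ φ₂ i₂ s t hs ht hst
      filter_upwards [i₁, i₂] with n j₁ j₂ w hw
      exact hconvI w 1 (j₁ w hw) (j₂ w hw) hs ht hst
    refine hc.mem_of_mem_convexHull_tail (fun k _ => ?_) hφ
    filter_upwards [eventually_ge_atTop k] with n hn w hw
    exact (hconvI' (ψ k) 1).mem_of_mem_convexHull_tail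
      (fun i hi => ⟨hint₀ k i, h1 k i (hn.trans hi)⟩) hw
  have hzero : ∀ w ∈ convexHull ℝ (v '' Set.Ici 0), ∀ᶠ k in atTop,
      ∀ φ ∈ convexHull ℝ (ψ '' Set.Ici k),
        Integrable (fun x => φ x (w x)) μ ∧ ∫ x, φ x (w x) ∂μ = 0 := by
    intro w hw
    have hc : Convex ℝ {w : X → B | ∀ᶠ k in atTop, ∀ φ ∈ convexHull ℝ (ψ '' Set.Ici k),
        Integrable (fun x => φ x (w x)) μ ∧ ∫ x, φ x (w x) ∂μ = 0} := by
      intro w₁ i₁ w₂ i₂ s t hs ht hst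
      filter_upwards [i₁, i₂] with k j₁ j₂ φ hφ
      exact hconvI' φ 0 (j₁ φ hφ) (j₂ φ hφ) hs ht hst
    refine hc.mem_of_mem_convexHull_tail (fun n _ => ?_) hw
    filter_upwards [eventually_gt_atTop n] with k hk φ hφ
    exact (hconvI (v n) 0).mem_of_mem_convexHull_tail
      (fun i hi => ⟨hint₀ i n, h0 i n (lt_of_lt_of_le hk hi)⟩) hφ
  -- Domination of both sequences.
  obtain ⟨v₁, hv₁, M, hM, hv₁M⟩ := exists_convexHull_tail_norm_le hp hp' v
    (fun n x => ‖v n x‖) (fun n => Eventually.of_forall fun x => le_rfl) (fun n => (hv n).norm) K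
    (fun n => by rw [eLpNorm_norm]; exact hvK n)
  obtain ⟨ψ₁, hψ₁, N, hN, hψ₁N⟩ := exists_convexHull_tail_norm_le hq hq' ψ g hψg hg K hgK
  have hMN : Integrable (fun x => N x * M x) μ := hN.integrable_mul (q := p) hM
  have hbound : ∀ φ : X → StrongDual ℝ B, ∀ w : X → B, (∀ᵐ x ∂μ, ‖φ x‖ ≤ N x) →
      (∀ᵐ x ∂μ, ‖w x‖ ≤ M x) → ∀ᵐ x ∂μ, |φ x (w x)| ≤ N x * M x := by
    intro φ w hφ hw
    filter_upwards [hφ, hw] with x e1 e2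
    exact ((φ x).le_opNorm _).trans
      (mul_le_mul e1 e2 (norm_nonneg _) ((norm_nonneg _).trans e1))
  -- The limits of the pairings in the first variable.
  obtain ⟨v₂, hv₂, hlim⟩ := exists_convexHull_tail_forall_tendsto v₁
    (fun k => LinearMap.pi fun x => (ψ₁ k x).toLinearMap ∘ₗ LinearMap.proj x)
    (fun k n => (hint _ (convexHull_tail_anti (Nat.zero_le _) (hψ₁ k)) _ (convexHull_tail_anti (Nat.zero_le _) (hv₁ n))).aemeasurable)
    (fun x => N x * M x) hMN.aemeasurable (fun k n => hbound _ _ (hψ₁N k) (hv₁M n))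
  have hv₂' : ∀ n, v₂ n ∈ convexHull ℝ (v '' Set.Ici n) := fun n => convexHull_tail_subset hv₁ n (hv₂ n)
  have hv₂M : ∀ n, ∀ᵐ x ∂μ, v₂ n x ∈ E x ∧ ‖v₂ n x‖ ≤ M x := by
    intro n
    have hc : Convex ℝ {w : X → B | ∀ᵐ x ∂μ, ‖w x‖ ≤ M x} := by
      intro w₁ i₁ w₂ i₂ s t hs ht hst
      change ∀ᵐ x ∂μ, _
      filter_upwards [i₁, i₂] with x e1 e2
      simpa using convex_closedBall (0 : B) (M x) (by simpa using e1) (by simpa using e2) hs ht hst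
    have hc' : Convex ℝ {w : X → B | ∀ᵐ x ∂μ, w x ∈ E x} := by
      intro w₁ i₁ w₂ i₂ s t hs ht hst
      change ∀ᵐ x ∂μ, _
      filter_upwards [i₁, i₂] with x e1 e2
      exact (E x).convex e1 e2 hs ht hst
    have e1 : ∀ᵐ x ∂μ, ‖v₂ n x‖ ≤ M x :=
      hc.mem_of_mem_convexHull_tail (fun i _ => hv₁M i) (hv₂ n)
    have e2 : ∀ᵐ x ∂μ, v₂ n x ∈ E x :=
      hc'.mem_of_mem_convexHull_tail (fun i _ => hvE i) (hv₂' n)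
    exact e2.and e1
  have hlim' : ∀ k, ∃ a : X → ℝ, ∀ᵐ x ∂μ, Tendsto (fun n => ψ₁ k x (v₂ n x)) atTop (𝓝 (a x)) := by
    intro k
    refine ⟨fun x => limUnder atTop fun n => ψ₁ k x (v₂ n x), ?_⟩
    filter_upwards [hlim] with x hx
    exact tendsto_nhds_limUnder (hx k)
  choose a₁ ha₁ using hlim'
  have ha₁m : ∀ k, AEMeasurable (a₁ k) μ := fun k =>
    aemeasurable_of_tendsto_metrizable_ae atTop
      (fun n => (hint _ (convexHull_tail_anti (Nat.zero_le _) (hψ₁ k)) _ (convexHull_tail_anti (Nat.zero_le _) (hv₂' n))).aemeasurable) (ha₁ k)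
  have ha₁b : ∀ k, ∀ᵐ x ∂μ, |a₁ k x| ≤ N x * M x := by
    intro k
    filter_upwards [ha₁ k, ae_all_iff.2 fun n => hbound _ _ (hψ₁N k) ((hv₂M n).mono fun x h => h.2)]
      with x e1 e2
    exact le_of_tendsto e1.abs (Eventually.of_forall e2)
  -- The limits of the pairings in the second variable, together with the iterated limits.
  obtain ⟨z, hz, hlim₂⟩ := exists_convexHull_tail_forall_tendsto (fun k => (ψ₁ k, a₁ k))
    (fun j => j.casesOn (LinearMap.snd ℝ (X → StrongDual ℝ B) (X → ℝ)) fun n =>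
      (LinearMap.pi fun x => (NormedSpace.inclusionInDoubleDual ℝ B (v₂ n x)).toLinearMap ∘ₗ
        LinearMap.proj x) ∘ₗ LinearMap.fst ℝ (X → StrongDual ℝ B) (X → ℝ))
    (fun j k => by
      cases j with
      | zero => exact ha₁m k
      | succ n => exact (hint _ (convexHull_tail_anti (Nat.zero_le _) (hψ₁ k)) _ (convexHull_tail_anti (Nat.zero_le _) (hv₂' n))).aemeasurable)
    (fun x => N x * M x) hMN.aemeasurable (fun j k => by
      cases j with
      | zero => exact ha₁b k
      | succ n => exact hbound _ _ (hψ₁N k) ((hv₂M n).mono fun x h => h.2))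
  set ψ₂ : ℕ → X → StrongDual ℝ B := fun k => (z k).1 with hψ₂d
  set a₂ : ℕ → X → ℝ := fun k => (z k).2 with ha₂d
  have hψ₂₁ : ∀ k, ψ₂ k ∈ convexHull ℝ (ψ₁ '' Set.Ici k) := fun k => by
    have := Set.mem_image_of_mem (LinearMap.fst ℝ (X → StrongDual ℝ B) (X → ℝ)) (hz k)
    rw [LinearMap.image_convexHull, Set.image_image] at this
    exact this
  have hψ₂ : ∀ k, ψ₂ k ∈ convexHull ℝ (ψ '' Set.Ici k) := fun k => convexHull_tail_subset hψ₁ k (hψ₂₁ k)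
  have ha₂ : ∀ k, ∀ᵐ x ∂μ, Tendsto (fun n => ψ₂ k x (v₂ n x)) atTop (𝓝 (a₂ k x)) := by
    intro k
    have hc : Convex ℝ {w : (X → StrongDual ℝ B) × (X → ℝ) |
        ∀ᵐ x ∂μ, Tendsto (fun n => w.1 x (v₂ n x)) atTop (𝓝 (w.2 x))} := by
      intro w₁ i₁ w₂ i₂ s t _ _ _
      change ∀ᵐ x ∂μ, _
      filter_upwards [i₁, i₂] with x e1 e2
      exact (e1.const_mul s).add (e2.const_mul t)
    exact hc.mem_of_mem_convexHull_tail (fun i _ => ha₁ i) (hz k)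
  have hψ₂N : ∀ k, ∀ᵐ x ∂μ, ‖ψ₂ k x‖ ≤ N x := by
    intro k
    have hc : Convex ℝ {φ : X → StrongDual ℝ B | ∀ᵐ x ∂μ, ‖φ x‖ ≤ N x} := by
      intro w₁ i₁ w₂ i₂ s t hs ht hst
      change ∀ᵐ x ∂μ, _
      filter_upwards [i₁, i₂] with x e1 e2
      simpa using convex_closedBall (0 : StrongDual ℝ B) (N x) (by simpa using e1)
        (by simpa using e2) hs ht hst
    exact hc.mem_of_mem_convexHull_tail (fun i _ => hψ₁N i) (hψ₂₁ k)
  have hI₂ : ∀ k n, Integrable (fun x => ψ₂ k x (v₂ n x)) μ := fun k n =>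
    hint _ (convexHull_tail_anti (Nat.zero_le _) (hψ₂ k)) _ (convexHull_tail_anti (Nat.zero_le _) (hv₂' n))
  have hb₂ : ∀ k n, ∀ᵐ x ∂μ, ‖ψ₂ k x (v₂ n x)‖ ≤ N x * M x := fun k n =>
    hbound _ _ (hψ₂N k) ((hv₂M n).mono fun x h => h.2)
  set a : X → ℝ := fun x => limUnder atTop fun k => a₂ k x with had
  have ha : ∀ᵐ x ∂μ, Tendsto (fun k => a₂ k x) atTop (𝓝 (a x)) := by
    filter_upwards [hlim₂] with x hx
    exact tendsto_nhds_limUnder (hx 0)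
  set b : ℕ → X → ℝ := fun n x => limUnder atTop fun k => ψ₂ k x (v₂ n x) with hbd
  have hb : ∀ n, ∀ᵐ x ∂μ, Tendsto (fun k => ψ₂ k x (v₂ n x)) atTop (𝓝 (b n x)) := by
    intro n
    filter_upwards [hlim₂] with x hx
    exact tendsto_nhds_limUnder (hx (n + 1))
  -- Reflexivity of the fibers.
  have hba : ∀ᵐ x ∂μ, Tendsto (fun n => b n x) atTop (𝓝 (a x)) := by
    filter_upwards [hE, ha, ae_all_iff.2 hb, ae_all_iff.2 ha₂, ae_all_iff.2 hv₂M,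
      ae_all_iff.2 hψ₂N] with x e1 e2 e3 e4 e5 e6
    refine e1.tendsto_of_iterated_limits (v := fun n => ⟨v₂ n x, (e5 n).1⟩)
      (ψ := fun k => (ψ₂ k x).comp (E x).subtypeL) (C := max (M x) (N x))
      (fun n => (e5 n).2.trans (le_max_left _ _)) (fun k => ?_) e4 e2 e3
    refine ContinuousLinearMap.opNorm_le_bound _
      ((norm_nonneg _).trans ((e6 k).trans (le_max_right _ _))) fun y => ?_
    refine ((ψ₂ k x).le_opNorm _).trans ?_
    exact mul_le_mul_of_nonneg_right ((e6 k).trans (le_max_right _ _)) (norm_nonneg _)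
  -- Dominated convergence for the iterated limits.
  have ha₂m : ∀ k, AEStronglyMeasurable (a₂ k) μ := fun k =>
    (aemeasurable_of_tendsto_metrizable_ae atTop (fun n => (hI₂ k n).aemeasurable)
      (ha₂ k)).aestronglyMeasurable
  have hbm : ∀ n, AEStronglyMeasurable (b n) μ := fun n =>
    (aemeasurable_of_tendsto_metrizable_ae atTop (fun k => (hI₂ k n).aemeasurable)
      (hb n)).aestronglyMeasurable
  have ha₂b : ∀ k, ∀ᵐ x ∂μ, ‖a₂ k x‖ ≤ N x * M x := by
    intro k
    filter_upwards [ha₂ k, ae_all_iff.2 (hb₂ k)] with x e1 e2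
    exact le_of_tendsto e1.norm (Eventually.of_forall e2)
  have hbb : ∀ n, ∀ᵐ x ∂μ, ‖b n x‖ ≤ N x * M x := by
    intro n
    filter_upwards [hb n, ae_all_iff.2 fun k => hb₂ k n] with x e1 e2
    exact le_of_tendsto e1.norm (Eventually.of_forall e2)
  have e1 : ∀ k, ∫ x, a₂ k x ∂μ = 1 := by
    intro k
    refine tendsto_nhds_unique (tendsto_integral_of_dominated_convergence _
      (fun n => (hI₂ k n).aestronglyMeasurable) hMN (hb₂ k) (ha₂ k)) ?_
    refine tendsto_const_nhds.congr' ?_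
    filter_upwards [hone _ (convexHull_tail_anti (Nat.zero_le _) (hψ₂ k))] with n hn
    exact (hn _ (hv₂' n)).2.symm
  have e2 : ∀ n, ∫ x, b n x ∂μ = 0 := by
    intro n
    refine tendsto_nhds_unique (tendsto_integral_of_dominated_convergence _
      (fun k => (hI₂ k n).aestronglyMeasurable) hMN (fun k => hb₂ k n) (hb n)) ?_
    refine tendsto_const_nhds.congr' ?_
    filter_upwards [hzero _ (convexHull_tail_anti (Nat.zero_le _) (hv₂' n))] with k hk
    exact (hk _ (hψ₂ k)).2.symm
  have e3 := tendsto_integral_of_dominated_convergence _ ha₂m hMN ha₂b ha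
  have e4 := tendsto_integral_of_dominated_convergence _ hbm hMN hbb hba
  simp only [e1, e2] at e3 e4
  have e5 := tendsto_nhds_unique e3 tendsto_const_nhds
  have e6 := tendsto_nhds_unique e4 tendsto_const_nhds
  exact one_ne_zero (e5.symm.trans e6)

/-! ### Essentially bounded functions -/

section BoundedFunctions

variable {X : Type*} [MeasurableSpace X] {μ : Measure X}

/-- The class in `L^∞` of a bounded measurable function. -/
noncomputable def boundedToLp (μ : Measure X) (f : X → ℝ) (hf : Measurable f)
    (C : ℝ) (hC : ∀ x, |f x| ≤ C) : Lp ℝ ∞ μ :=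
  (memLp_top_of_bound hf.aestronglyMeasurable C (Eventually.of_forall hC)).toLp f

theorem coeFn_boundedToLp (f : X → ℝ) (hf : Measurable f) (C : ℝ) (hC : ∀ x, |f x| ≤ C) :
    boundedToLp μ f hf C hC =ᵐ[μ] f :=
  MemLp.coeFn_toLp _

theorem ae_norm_le_norm_top (f : Lp ℝ ∞ μ) : ∀ᵐ x ∂μ, |f x| ≤ ‖f‖ := by
  filter_upwards [ae_le_eLpNormEssSup (f := f) (μ := μ)] with x hx
  rw [Lp.norm_def, ← Real.norm_eq_abs, ← toReal_enorm, eLpNorm_exponent_top]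
  exact ENNReal.toReal_mono (by
    rw [← eLpNorm_exponent_top]
    exact (Lp.memLp f).eLpNorm_ne_top) hx

theorem integrable_Linfty_mul (f : Lp ℝ ∞ μ) (h : Lp ℝ 1 μ) :
    Integrable (fun x => f x * h x) μ :=
  (L1.integrable_coeFn h).bdd_mul (Lp.stronglyMeasurable f).aestronglyMeasurable
    (ae_norm_le_norm_top f)

theorem exists_Linfty_mul_eq_abs (h : Lp ℝ 1 μ) :
    ∃ f : Lp ℝ ∞ μ, (∀ᵐ x ∂μ, |f x| ≤ 1) ∧ ∀ᵐ x ∂μ, f x * h x = |h x| := by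
  have hm : MeasurableSet {x | 0 ≤ h x} :=
    measurableSet_le measurable_const (Lp.stronglyMeasurable h).measurable
  have hb : ∀ x, |({x | 0 ≤ h x}.piecewise (fun _ => 1) (fun _ => -1) : X → ℝ) x| ≤ 1 := by
    intro x
    by_cases hx : 0 ≤ h x <;> simp [Set.piecewise, hx]
  have e := coeFn_boundedToLp (μ := μ) _ (Measurable.piecewise hm measurable_const measurable_const)
    1 hb
  refine ⟨_, e.mono fun x hx => by rw [hx]; exact hb x, ?_⟩
  filter_upwards [e] with x hx
  rw [hx]
  by_cases h0 : 0 ≤ h x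
  · simp [Set.piecewise, h0, abs_of_nonneg h0]
  · simp [Set.piecewise, h0, abs_of_neg (not_le.1 h0)]

/-- Integrable functions are determined by their integrals against bounded functions. -/
theorem L1_ext_of_integral_mul {h k : Lp ℝ 1 μ}
    (e : ∀ f : Lp ℝ ∞ μ, ∫ x, f x * h x ∂μ = ∫ x, f x * k x ∂μ) : h = k := by
  obtain ⟨f, -, hf⟩ := exists_Linfty_mul_eq_abs (h - k)
  have h1 : ∫ x, |(h - k : Lp ℝ 1 μ) x| ∂μ = 0 := by
    rw [← integral_congr_ae hf]
    have h2 : ∀ᵐ x ∂μ, f x * (h - k : Lp ℝ 1 μ) x = f x * h x - f x * k x := by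
      filter_upwards [Lp.coeFn_sub h k] with x hx
      rw [hx, Pi.sub_apply, mul_sub]
    rw [integral_congr_ae h2, integral_sub (integrable_Linfty_mul f h) (integrable_Linfty_mul f k),
      e f, sub_self]
  rw [← sub_eq_zero, ← norm_eq_zero, L1.norm_eq_integral_norm]
  exact h1

end BoundedFunctions

namespace BanachBundle

variable {X : Type*} [MeasurableSpace X] {μ : Measure X}
  {B : Type*} [NormedAddCommGroup B] [NormedSpace ℝ B] {E : BanachBundle X B} {p : ℝ≥0∞}

/-! ### The space of sections -/

/-- The values of a section may be corrected on a null set, so the fiber condition needs to hold only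
almost everywhere. -/
theorem mem_sectionSpace_iff {u : Lp B p μ} :
    u ∈ E.sectionSpace p μ ↔ ∀ᵐ x ∂μ, u x ∈ E.fiber x := by
  classical
  constructor
  · rintro ⟨v, hv, e⟩
    filter_upwards [e] with x hx
    rw [hx]
    exact hv.2 x
  · intro h
    obtain ⟨s, hs, hsm, hs0⟩ := h.exists_measurable_mem
    refine ⟨s.indicator u, ⟨(Lp.stronglyMeasurable u).indicator hsm, fun x => ?_⟩, ?_⟩
    · by_cases hx : x ∈ s
      · rw [Set.indicator_of_mem hx]
        exact hs0 x hx
      · rw [Set.indicator_of_notMem hx]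
        exact (E.fiber x).zero_mem
    · filter_upwards [hs] with x hx
      rw [Set.indicator_of_mem hx]

theorem ae_mem_fiber (v : E.sectionSpace p μ) : ∀ᵐ x ∂μ, (v : Lp B p μ) x ∈ E.fiber x :=
  mem_sectionSpace_iff.1 v.2

theorem isClosed_sectionSpace [Fact (1 ≤ p)] :
    IsClosed (E.sectionSpace p μ : Set (Lp B p μ)) := by
  refine isClosed_of_closure_subset fun u hu => ?_
  obtain ⟨w, hw, hwu⟩ := mem_closure_iff_seq_limit.1 hu
  obtain ⟨n, -, hn⟩ := (tendstoInMeasure_of_tendsto_Lp hwu).exists_seq_tendsto_ae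
  refine mem_sectionSpace_iff.2 ?_
  filter_upwards [hn, ae_all_iff.2 fun k => mem_sectionSpace_iff.1 (hw k)] with x h1 h2
  exact (E.isClosed_fiber x).mem_of_tendsto h1 (Eventually.of_forall fun k => h2 _)

theorem coeFn_mulSection (f : Lp ℝ ∞ μ) (v : E.sectionSpace p μ) :
    ((mulSection f v : E.sectionSpace p μ) : Lp B p μ) =ᵐ[μ] fun x => f x • (v : Lp B p μ) x :=
  Lp.coeFn_lpSMul (r := p) f (v : Lp B p μ)

theorem section_ext {v w : E.sectionSpace p μ} (h : (v : Lp B p μ) =ᵐ[μ] (w : Lp B p μ)) : v = w :=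
  Subtype.ext (Lp.ext h)

theorem coeFn_section_add (v w : E.sectionSpace p μ) :
    ((v + w : E.sectionSpace p μ) : Lp B p μ) =ᵐ[μ] fun x => (v : Lp B p μ) x + (w : Lp B p μ) x :=
  Lp.coeFn_add _ _

theorem coeFn_section_sub (v w : E.sectionSpace p μ) :
    ((v - w : E.sectionSpace p μ) : Lp B p μ) =ᵐ[μ] fun x => (v : Lp B p μ) x - (w : Lp B p μ) x :=
  Lp.coeFn_sub _ _

theorem coeFn_section_smul (c : ℝ) (v : E.sectionSpace p μ) :
    ((c • v : E.sectionSpace p μ) : Lp B p μ) =ᵐ[μ] fun x => c • (v : Lp B p μ) x :=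
  Lp.coeFn_smul _ _

/-- Multiplication of a fixed section by bounded functions, as a linear map. -/
noncomputable def mulSectionLeft (v : E.sectionSpace p μ) : Lp ℝ ∞ μ →ₗ[ℝ] E.sectionSpace p μ where
  toFun f := mulSection f v
  map_add' f g := by
    refine section_ext ?_
    filter_upwards [coeFn_mulSection (f + g) v, coeFn_mulSection f v, coeFn_mulSection g v,
      coeFn_section_add (mulSection f v) (mulSection g v), Lp.coeFn_add f g] with x h1 h2 h3 h4 h5
    rw [h1, h4, h2, h3, h5, Pi.add_apply, add_smul]
  map_smul' c f := by
    refine section_ext ?_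
    filter_upwards [coeFn_mulSection (c • f) v, coeFn_mulSection f v,
      coeFn_section_smul c (mulSection f v), Lp.coeFn_smul c f] with x h1 h2 h3 h4
    simp only [RingHom.id_apply]
    rw [h1, h3, h2, h4, Pi.smul_apply, smul_assoc]

theorem mulSection_add (f : Lp ℝ ∞ μ) (v w : E.sectionSpace p μ) :
    mulSection f (v + w) = mulSection f v + mulSection f w := by
  refine section_ext ?_
  filter_upwards [coeFn_mulSection f (v + w), coeFn_mulSection f v, coeFn_mulSection f w,
    coeFn_section_add (mulSection f v) (mulSection f w), coeFn_section_add v w]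
    with x h1 h2 h3 h4 h5
  rw [h1, h4, h2, h3, h5, smul_add]

theorem mulSection_smul (f : Lp ℝ ∞ μ) (c : ℝ) (v : E.sectionSpace p μ) :
    mulSection f (c • v) = c • mulSection f v := by
  refine section_ext ?_
  filter_upwards [coeFn_mulSection f (c • v), coeFn_mulSection f v,
    coeFn_section_smul c (mulSection f v), coeFn_section_smul c v] with x h1 h2 h3 h4
  rw [h1, h3, h2, h4, smul_comm]

theorem norm_le_norm_of_ae_le [Fact (1 ≤ p)] {v w : E.sectionSpace p μ}
    (h : ∀ᵐ x ∂μ, ‖(v : Lp B p μ) x‖ ≤ ‖(w : Lp B p μ) x‖) : ‖v‖ ≤ ‖w‖ :=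
  Lp.norm_le_norm_of_ae_le h

/-- Dominated convergence for products of a section with bounded functions. -/
theorem tendsto_mulSection [Fact (1 ≤ p)] (hp' : p ≠ ∞) {ι : Type*} {l : Filter ι}
    [l.IsCountablyGenerated] (f : ι → Lp ℝ ∞ μ) (f₀ : Lp ℝ ∞ μ) (C : ℝ)
    (hC : ∀ i, ∀ᵐ x ∂μ, |f i x| ≤ C) (hf : ∀ᵐ x ∂μ, Tendsto (fun i => f i x) l (𝓝 (f₀ x)))
    (v : E.sectionSpace p μ) :
    Tendsto (fun i => mulSection (f i) v) l (𝓝 (mulSection f₀ v)) := by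
  have hp0 : p ≠ 0 := (zero_lt_one.trans_le Fact.out).ne'
  have hr0 : 0 < p.toReal := ENNReal.toReal_pos hp0 hp'
  rw [tendsto_iff_norm_sub_tendsto_zero]
  have key : Tendsto (fun i => ‖mulSection (f i) v - mulSection f₀ v‖ ^ p.toReal) l (𝓝 0) := by
    have e : ∀ i, ‖mulSection (f i) v - mulSection f₀ v‖ ^ p.toReal =
        ∫ x, (|f i x - f₀ x| * ‖(v : Lp B p μ) x‖) ^ p.toReal ∂μ := by
      intro i
      refine (norm_rpow_eq_integral hp' ((mulSection (f i) v - mulSection f₀ v :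
        E.sectionSpace p μ) : Lp B p μ)).trans (integral_congr_ae ?_)
      filter_upwards [coeFn_section_sub (mulSection (f i) v) (mulSection f₀ v),
        coeFn_mulSection (f i) v, coeFn_mulSection f₀ v] with x h1 h2 h3
      rw [h1, h2, h3, ← sub_smul, norm_smul, Real.norm_eq_abs]
    simp only [e]
    rw [show (0 : ℝ) = ∫ x, (0 : ℝ) ∂μ by simp]
    refine tendsto_integral_filter_of_dominated_convergence
      (fun x => (|C| + ‖f₀‖) ^ p.toReal * ‖(v : Lp B p μ) x‖ ^ p.toReal) ?_ ?_ ?_ ?_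
    · refine Eventually.of_forall fun i => ?_
      have h1 := (Lp.stronglyMeasurable (f i)).measurable
      have h2 := (Lp.stronglyMeasurable f₀).measurable
      have h3 := (Lp.stronglyMeasurable (v : Lp B p μ)).norm.measurable
      exact (((h1.sub h2).abs.mul h3).pow_const p.toReal).aestronglyMeasurable
    · refine Eventually.of_forall fun i => ?_
      filter_upwards [hC i, ae_norm_le_norm_top f₀] with x h1 h2
      rw [Real.norm_of_nonneg (by positivity), ← Real.mul_rpow (by positivity) (norm_nonneg _)]
      gcongr
      exact (abs_sub _ _).trans (add_le_add (h1.trans (le_abs_self C)) h2)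
    · exact ((Lp.memLp (v : Lp B p μ)).integrable_norm_rpow hp0 hp').const_mul _
    · filter_upwards [hf] with x hx
      have h1 : Tendsto (fun i => |f i x - f₀ x| * ‖(v : Lp B p μ) x‖) l (𝓝 0) := by
        have := ((hx.sub_const (f₀ x)).abs).mul_const ‖(v : Lp B p μ) x‖
        simpa using this
      have := h1.rpow_const (p := p.toReal) (Or.inr hr0.le)
      simpa [Real.zero_rpow hr0.ne'] using this
  have := key.rpow_const (p := p.toReal⁻¹) (Or.inr (inv_nonneg.2 hr0.le))
  rw [Real.zero_rpow (inv_ne_zero hr0.ne')] at this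
  refine this.congr fun i => ?_
  rw [← Real.rpow_mul (norm_nonneg _), mul_inv_cancel₀ hr0.ne', Real.rpow_one]

/-! ### Functionals on sections as integrals of module functionals -/

/-- The values of a functional at the restrictions of a section to measurable sets form a signed
measure. -/
theorem exists_signedMeasure_eq [Fact (1 ≤ p)] (hp' : p ≠ ∞)
    (φ : StrongDual ℝ (E.sectionSpace p μ)) (v : E.sectionSpace p μ) :
    ∃ m : SignedMeasure X, ∀ s (hs : MeasurableSet s),
      m s = φ (mulSection (boundedToLp μ (s.indicator 1) (measurable_one.indicator hs) 1
        (fun x => by by_cases hx : x ∈ s <;> simp [hx])) v) := by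
  classical
  set ind : ∀ s : Set X, MeasurableSet s → Lp ℝ ∞ μ := fun s hs =>
    boundedToLp μ (s.indicator 1) (measurable_one.indicator hs) 1
      (fun x => by by_cases hx : x ∈ s <;> simp [hx]) with hind
  have hcoe : ∀ s hs, ind s hs =ᵐ[μ] s.indicator 1 := fun s hs => coeFn_boundedToLp _ _ _ _
  refine ⟨⟨fun s => if hs : MeasurableSet s then φ (mulSection (ind s hs) v) else 0, ?_, ?_, ?_⟩,
    fun s hs => dif_pos hs⟩
  · have h0 : ind ∅ MeasurableSet.empty = 0 := by
      refine Lp.ext ?_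
      filter_upwards [hcoe ∅ MeasurableSet.empty, Lp.coeFn_zero ℝ ∞ μ] with x h1 h2
      rw [h1, h2]
      simp
    rw [dif_pos MeasurableSet.empty, h0]
    exact (congrArg φ (map_zero (mulSectionLeft v))).trans (map_zero φ)
  · intro s hs
    rw [dif_neg hs]
  · intro f hf hd
    simp only [hf, MeasurableSet.iUnion hf, dif_pos]
    -- At each point at most one of the indicator functions does not vanish.
    have hsum : ∀ x, HasSum (fun i => (f i).indicator (1 : X → ℝ) x)
        ((⋃ i, f i).indicator (1 : X → ℝ) x) := by
      intro x
      by_cases hx : x ∈ ⋃ i, f i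
      · obtain ⟨i, hi⟩ := Set.mem_iUnion.1 hx
        rw [Set.indicator_of_mem hx]
        have h1 := hasSum_single (f := fun i => (f i).indicator (1 : X → ℝ) x) i fun j hj =>
          Set.indicator_of_notMem (fun hxj => Set.disjoint_left.1 (hd hj) hxj hi) _
        simpa only [Set.indicator_of_mem hi, Pi.one_apply] using h1
      · rw [Set.indicator_of_notMem hx]
        have : ∀ i, (f i).indicator (1 : X → ℝ) x = 0 := fun i =>
          Set.indicator_of_notMem (fun hi => hx (Set.mem_iUnion.2 ⟨i, hi⟩)) _
        simp only [this]
        exact hasSum_zero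
    have hpart : ∀ s : Finset ℕ, ((∑ i ∈ s, ind (f i) (hf i) : Lp ℝ ∞ μ) : X → ℝ) =ᵐ[μ]
        fun x => ∑ i ∈ s, (f i).indicator (1 : X → ℝ) x := by
      intro s
      filter_upwards [Lp.coeFn_fun_finsetSum s fun i => ind (f i) (hf i),
        ae_all_iff.2 fun i => hcoe (f i) (hf i)] with x h1 h2
      rw [h1]
      exact Finset.sum_congr rfl fun i _ => h2 i
    have hnn : ∀ i x, 0 ≤ (f i).indicator (1 : X → ℝ) x := fun i x =>
      Set.indicator_nonneg (fun _ _ => zero_le_one) x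
    have hlim := tendsto_mulSection (l := atTop) hp' (fun s : Finset ℕ => ∑ i ∈ s, ind (f i) (hf i))
      (ind _ (MeasurableSet.iUnion hf)) 1 (fun s => by
        filter_upwards [hpart s] with x hx
        rw [hx, abs_of_nonneg (Finset.sum_nonneg fun i _ => hnn i x)]
        refine (sum_le_hasSum s (fun i _ => hnn i x) (hsum x)).trans ?_
        exact Set.indicator_le_self' (fun _ _ => zero_le_one) x)
      (by
        filter_upwards [ae_all_iff.2 hpart, hcoe _ (MeasurableSet.iUnion hf)] with x h1 h2
        simp only [h1, h2]
        exact hsum x) v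
    refine ((φ.continuous.tendsto _).comp hlim).congr fun s => ?_
    rw [Function.comp_apply]
    have : mulSection (∑ i ∈ s, ind (f i) (hf i)) v = ∑ i ∈ s, mulSection (ind (f i) (hf i)) v :=
      map_sum (mulSectionLeft v) _ s
    rw [this, map_sum]

/-- A functional, restricted to the multiples of one section, is given by a density. -/
theorem exists_density [Fact (1 ≤ p)] (hp' : p ≠ ∞) [SigmaFinite μ]
    (φ : StrongDual ℝ (E.sectionSpace p μ)) (v : E.sectionSpace p μ) :
    ∃ h : Lp ℝ 1 μ, ∀ f : Lp ℝ ∞ μ, φ (mulSection f v) = ∫ x, f x * h x ∂μ := by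
  classical
  obtain ⟨m, hm⟩ := exists_signedMeasure_eq hp' φ v
  have hac : m ≪ᵥ μ.toENNRealVectorMeasure := by
    refine VectorMeasure.AbsolutelyContinuous.mk fun s hs h0 => ?_
    rw [Measure.toENNRealVectorMeasure_apply_measurable hs] at h0
    rw [hm s hs]
    have : boundedToLp μ (s.indicator 1) (measurable_one.indicator hs) 1
        (fun x => by by_cases hx : x ∈ s <;> simp [hx]) = 0 := by
      refine Lp.ext ?_
      filter_upwards [coeFn_boundedToLp (μ := μ) (s.indicator 1) (measurable_one.indicator hs) 1
        (fun x => by by_cases hx : x ∈ s <;> simp [hx]), Lp.coeFn_zero ℝ ∞ μ,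
        measure_eq_zero_iff_ae_notMem.1 h0] with x h1 h2 h3
      rw [h1, h2, Set.indicator_of_notMem h3]
      rfl
    rw [this]
    exact (congrArg φ (map_zero (mulSectionLeft v))).trans (map_zero φ)
  have hi : Integrable (m.rnDeriv μ) μ := SignedMeasure.integrable_rnDeriv m μ
  set h : Lp ℝ 1 μ := hi.toL1 _ with hh
  have hh' : h =ᵐ[μ] m.rnDeriv μ := hi.coeFn_toL1
  have hset : ∀ s, MeasurableSet s → ∫ x in s, h x ∂μ = m s := by
    intro s hs
    rw [integral_congr_ae (ae_restrict_of_ae hh'), ← withDensityᵥ_apply hi hs,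
      SignedMeasure.withDensityᵥ_rnDeriv_eq m μ hac]
  refine ⟨h, fun f => ?_⟩
  -- First for simple functions, then by approximation.
  have hsimple : ∀ g : SimpleFunc X ℝ, φ (mulSection ((SimpleFunc.memLp_top g μ).toLp g) v) =
      ∫ x, g x * h x ∂μ := by
    intro g
    induction g using SimpleFunc.induction with
    | const c hs =>
      rename_i s
      have e1 : (SimpleFunc.memLp_top (SimpleFunc.piecewise s hs (SimpleFunc.const X c)
          (SimpleFunc.const X 0)) μ).toLp _ =
          c • boundedToLp μ (s.indicator 1) (measurable_one.indicator hs) 1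
            (fun x => by by_cases hx : x ∈ s <;> simp [hx]) := by
        refine Lp.ext ?_
        filter_upwards [MemLp.coeFn_toLp (SimpleFunc.memLp_top (SimpleFunc.piecewise s hs
          (SimpleFunc.const X c) (SimpleFunc.const X 0)) μ), Lp.coeFn_smul c (boundedToLp μ
          (s.indicator 1) (measurable_one.indicator hs) 1
            (fun x => by by_cases hx : x ∈ s <;> simp [hx])), coeFn_boundedToLp (μ := μ)
          (s.indicator 1) (measurable_one.indicator hs) 1
            (fun x => by by_cases hx : x ∈ s <;> simp [hx])] with x h1 h2 h3
        rw [h1, h2, Pi.smul_apply, h3]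
        by_cases hx : x ∈ s <;> simp [hx]
      rw [e1]
      have e2 := map_smul (mulSectionLeft v) c (boundedToLp μ (s.indicator 1)
        (measurable_one.indicator hs) 1 (fun x => by by_cases hx : x ∈ s <;> simp [hx]))
      refine (congrArg φ e2).trans ?_
      rw [map_smul]
      refine (congrArg (c • ·) (hm s hs).symm).trans ?_
      rw [← hset s hs, smul_eq_mul, ← integral_const_mul, ← integral_indicator hs]
      refine integral_congr_ae (Eventually.of_forall fun x => ?_)
      by_cases hx : x ∈ s <;> simp [hx]
    | add hd h₁ h₂ =>
      rename_i g₁ g₂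
      have e1 : (SimpleFunc.memLp_top (g₁ + g₂) μ).toLp _ =
          (SimpleFunc.memLp_top g₁ μ).toLp _ + (SimpleFunc.memLp_top g₂ μ).toLp _ := by
        rw [← MemLp.toLp_add]
        rfl
      have e2 := map_add (mulSectionLeft v) ((SimpleFunc.memLp_top g₁ μ).toLp _)
        ((SimpleFunc.memLp_top g₂ μ).toLp _)
      rw [e1]
      refine (congrArg φ e2).trans ?_
      rw [map_add]
      refine (congrArg₂ (· + ·) h₁ h₂).trans ?_
      have hi : ∀ g : SimpleFunc X ℝ, Integrable (fun x => g x * h x) μ := fun g => by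
        refine (integrable_Linfty_mul ((SimpleFunc.memLp_top g μ).toLp g) h).congr ?_
        filter_upwards [MemLp.coeFn_toLp (SimpleFunc.memLp_top g μ)] with x hx
        rw [hx]
      rw [← integral_add (hi g₁) (hi g₂)]
      exact integral_congr_ae (Eventually.of_forall fun x => by simp [add_mul])
  set C := ‖f‖ with hC
  have hfm := Lp.stronglyMeasurable f
  set g : ℕ → SimpleFunc X ℝ := hfm.approxBounded C with hg
  have hgC : ∀ n x, |g n x| ≤ C := fun n x =>
    hfm.norm_approxBounded_le (norm_nonneg f) n x
  have hgl : ∀ᵐ x ∂μ, Tendsto (fun n => g n x) atTop (𝓝 (f x)) :=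
    hfm.tendsto_approxBounded_ae (ae_norm_le_norm_top f)
  have hgc := ae_all_iff.2 fun n => MemLp.coeFn_toLp (SimpleFunc.memLp_top (g n) μ)
  have t1 := tendsto_mulSection hp' (fun n => (SimpleFunc.memLp_top (g n) μ).toLp (g n)) f C
    (fun n => by
      filter_upwards [hgc] with x hx
      rw [hx]
      exact hgC n x)
    (by
      filter_upwards [hgc, hgl] with x h1 h2
      simpa only [h1] using h2) v
  have t2 := (φ.continuous.tendsto _).comp t1
  have t3 : Tendsto (fun n => ∫ x, g n x * h x ∂μ) atTop (𝓝 (∫ x, f x * h x ∂μ)) := by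
    refine tendsto_integral_of_dominated_convergence (fun x => C * |h x|) (fun n => ?_) ?_ ?_ ?_
    · exact ((g n).aestronglyMeasurable).mul (Lp.stronglyMeasurable h).aestronglyMeasurable
    · exact (L1.integrable_coeFn h).abs.const_mul C
    · refine fun n => Eventually.of_forall fun x => ?_
      rw [norm_mul]
      exact mul_le_mul_of_nonneg_right (hgC n x) (norm_nonneg _)
    · filter_upwards [hgl] with x hx
      exact hx.mul_const _
  refine tendsto_nhds_unique t2 ?_
  simpa only [Function.comp_def, hsimple] using t3

/-- Integration of the values of an element of the module dual. -/
noncomputable def integralFunctional [Fact (1 ≤ p)] (ω : E.moduleDual p μ) :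
    StrongDual ℝ (E.sectionSpace p μ) :=
  (L1.integralCLM (α := X) (E := ℝ) (μ := μ)).comp ω.1

theorem integralFunctional_apply [Fact (1 ≤ p)] (ω : E.moduleDual p μ) (v : E.sectionSpace p μ) :
    integralFunctional ω v = ∫ x, ω.1 v x ∂μ := by
  rw [← L1.integral_eq_integral, L1.integral_eq]
  rfl

theorem integralFunctional_mulSection [Fact (1 ≤ p)] (ω : E.moduleDual p μ) (f : Lp ℝ ∞ μ)
    (v : E.sectionSpace p μ) :
    integralFunctional ω (mulSection f v) = ∫ x, f x * ω.1 v x ∂μ := by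
  rw [integralFunctional_apply, ω.2 f v]
  exact integral_congr_ae (Lp.coeFn_lpSMul (r := 1) f (ω.1 v))

/-- Every functional on the section space is obtained by integrating an element of the module
dual. -/
theorem integralFunctional_surjective [Fact (1 ≤ p)] (hp' : p ≠ ∞) [SigmaFinite μ] :
    Function.Surjective (integralFunctional (E := E) (p := p) (μ := μ)) := by
  intro φ
  choose T hT using exists_density (E := E) hp' φ
  have hadd : ∀ v w, T (v + w) = T v + T w := fun v w => by
    refine L1_ext_of_integral_mul fun f => ?_
    rw [← hT, mulSection_add, map_add, hT, hT,
      ← integral_add (integrable_Linfty_mul f _) (integrable_Linfty_mul f _)]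
    refine integral_congr_ae ?_
    filter_upwards [Lp.coeFn_add (T v) (T w)] with x hx
    rw [hx, Pi.add_apply, mul_add]
  have hsmul : ∀ (c : ℝ) v, T (c • v) = c • T v := fun c v => by
    refine L1_ext_of_integral_mul fun f => ?_
    rw [← hT, mulSection_smul, map_smul, hT, smul_eq_mul, ← integral_const_mul]
    refine integral_congr_ae ?_
    filter_upwards [Lp.coeFn_smul c (T v)] with x hx
    rw [hx, Pi.smul_apply, smul_eq_mul]
    ring
  have hbd : ∀ v, ‖T v‖ ≤ ‖φ‖ * ‖v‖ := fun v => by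
    obtain ⟨f, hf1, hf⟩ := exists_Linfty_mul_eq_abs (T v)
    have h1 : ‖T v‖ = φ (mulSection f v) := by
      rw [hT, integral_congr_ae hf, L1.norm_eq_integral_norm]
      rfl
    rw [h1]
    refine (le_abs_self _).trans ((φ.le_opNorm _).trans ?_)
    gcongr
    refine norm_le_norm_of_ae_le ?_
    filter_upwards [coeFn_mulSection f v, hf1] with x h2 h3
    rw [h2, norm_smul]
    exact mul_le_of_le_one_left (norm_nonneg _) h3
  set ω₀ : E.sectionSpace p μ →L[ℝ] Lp ℝ 1 μ :=
    LinearMap.mkContinuous ⟨⟨T, hadd⟩, hsmul⟩ ‖φ‖ hbd with hω₀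
  have hω₀T : ∀ v, ω₀ v = T v := fun v => rfl
  refine ⟨⟨ω₀, fun f v => ?_⟩, ?_⟩
  · rw [hω₀T, hω₀T]
    refine L1_ext_of_integral_mul fun g => ?_
    have e : mulSection g (mulSection f v) = mulSection (g • f : Lp ℝ ∞ μ) v := by
      refine section_ext ?_
      filter_upwards [coeFn_mulSection g (mulSection f v), coeFn_mulSection f v,
        coeFn_mulSection (g • f : Lp ℝ ∞ μ) v, Lp.coeFn_lpSMul (r := ∞) g f] with x h1 h2 h3 h4
      rw [h1, h2, h3, h4, Pi.smul_apply', smul_assoc]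
    rw [← hT, e, hT]
    refine integral_congr_ae ?_
    filter_upwards [Lp.coeFn_lpSMul (r := ∞) g f, Lp.coeFn_lpSMul (r := 1) f (T v)] with x h1 h2
    rw [h1, h2, Pi.smul_apply', Pi.smul_apply', smul_eq_mul, smul_eq_mul, mul_assoc]
  · ext v
    set one : Lp ℝ ∞ μ := boundedToLp μ 1 measurable_one 1 (fun x => by simp) with hone
    have h1 : one =ᵐ[μ] 1 := coeFn_boundedToLp _ _ _ _
    have e : mulSection one v = v := by
      refine section_ext ?_
      filter_upwards [coeFn_mulSection one v, h1] with x h2 h3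
      rw [h2, h3, Pi.one_apply, one_smul]
    rw [integralFunctional_apply]
    conv_rhs => rw [← e, hT]
    refine integral_congr_ae ?_
    filter_upwards [h1] with x h3
    rw [h3, Pi.one_apply, one_mul]
    rfl

end BanachBundle

/-! ### The pointwise norm of a module functional -/

/-- A directed family of nonnegative functions with bounded integrals has an essential supremum,
which is the supremum of a sequence in the family. -/
theorem exists_seq_ae_le_iSup {X : Type*} [MeasurableSpace X] {μ : Measure X}
    {H : Set (X → ℝ≥0∞)} (hne : H.Nonempty) (hm : ∀ h ∈ H, AEMeasurable h μ)
    (hd : ∀ h ∈ H, ∀ k ∈ H, ∃ l ∈ H, ∀ᵐ x ∂μ, max (h x) (k x) ≤ l x) {C : ℝ≥0∞} (hC : C ≠ ∞)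
    (hHC : ∀ h ∈ H, ∫⁻ x, h x ∂μ ≤ C) :
    ∃ s : ℕ → X → ℝ≥0∞, (∀ n, s n ∈ H) ∧ ∫⁻ x, ⨆ n, s n x ∂μ ≤ C ∧
      ∀ h ∈ H, ∀ᵐ x ∂μ, h x ≤ ⨆ n, s n x := by
  set α := sSup ((fun h : X → ℝ≥0∞ => ∫⁻ x, h x ∂μ) '' H) with hα
  have hle : ∀ h ∈ H, ∫⁻ x, h x ∂μ ≤ α := fun h hh => le_sSup ⟨h, hh, rfl⟩
  have hαC : α ≤ C := sSup_le (by rintro _ ⟨h, hh, rfl⟩; exact hHC h hh)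
  obtain ⟨t, -, htl, htH⟩ := exists_seq_tendsto_sSup (hne.image fun h : X → ℝ≥0∞ => ∫⁻ x, h x ∂μ)
    (OrderTop.bddAbove _)
  choose t' ht'H ht' using htH
  choose! F hFH hF using hd
  -- An increasing sequence in the family whose integrals tend to the supremum.
  set s : ℕ → X → ℝ≥0∞ := fun n => Nat.rec (t' 0) (fun n r => F r (t' (n + 1))) n with hs
  have hsH : ∀ n, s n ∈ H := by
    intro n
    induction n with
    | zero => exact ht'H 0
    | succ n ih => exact hFH _ ih _ (ht'H (n + 1))
  have hstep : ∀ n, ∀ᵐ x ∂μ, max (s n x) (t' (n + 1) x) ≤ s (n + 1) x := fun n =>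
    hF _ (hsH n) _ (ht'H (n + 1))
  have hmono : ∀ᵐ x ∂μ, Monotone fun n => s n x := by
    filter_upwards [ae_all_iff.2 hstep] with x hx
    exact monotone_nat_of_le_succ fun n => (le_max_left _ _).trans (hx n)
  have hts : ∀ n, ∫⁻ x, t' n x ∂μ ≤ ∫⁻ x, s n x ∂μ := by
    intro n
    cases n with
    | zero => exact le_rfl
    | succ n => exact lintegral_mono_ae ((hstep n).mono fun x hx => (le_max_right _ _).trans hx)
  have hint : ∫⁻ x, ⨆ n, s n x ∂μ = α := by
    rw [lintegral_iSup' (fun n => hm _ (hsH n)) hmono]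
    refine le_antisymm (iSup_le fun n => hle _ (hsH n)) ?_
    refine le_of_tendsto htl (Eventually.of_forall fun n => ?_)
    rw [← ht' n]
    exact (hts n).trans (le_iSup (fun n => ∫⁻ x, s n x ∂μ) n)
  refine ⟨s, hsH, hint.le.trans hαC, fun h hh => ?_⟩
  have hmax : ∫⁻ x, ⨆ n, max (s n x) (h x) ∂μ ≤ α := by
    rw [lintegral_iSup' (fun n => (hm _ (hsH n)).max (hm h hh))
      (hmono.mono fun x hx i j hij => max_le_max (hx hij) le_rfl)]
    refine iSup_le fun n => ?_
    exact (lintegral_mono_ae (hF _ (hsH n) h hh)).trans (hle _ (hFH _ (hsH n) h hh))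
  have heq := ae_eq_of_ae_le_of_lintegral_le (μ := μ) (f := fun x => ⨆ n, s n x)
    (g := fun x => ⨆ n, max (s n x) (h x))
    (Eventually.of_forall fun x => iSup_mono fun n => le_max_left _ _)
    (by rw [hint]; exact (hαC.trans_lt hC.lt_top).ne)
    (AEMeasurable.iSup fun n => (hm _ (hsH n)).max (hm h hh)) (by rw [hint]; exact hmax)
  filter_upwards [heq] with x hx
  rw [hx]
  exact (le_max_right (s 0 x) (h x)).trans (le_iSup (fun n => max (s n x) (h x)) 0)

namespace BanachBundle

variable {X : Type*} [MeasurableSpace X] {μ : Measure X}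
  {B : Type*} [NormedAddCommGroup B] [NormedSpace ℝ B] {E : BanachBundle X B} {p q : ℝ≥0∞}

theorem coeFn_moduleDual_mulSection [Fact (1 ≤ p)] (ω : E.moduleDual p μ) (f : Lp ℝ ∞ μ)
    (v : E.sectionSpace p μ) :
    (ω.1 (mulSection f v) : X → ℝ) =ᵐ[μ] fun x => f x * ω.1 v x := by
  rw [ω.2 f v]
  exact Lp.coeFn_lpSMul (r := 1) f (ω.1 v)

/-- The values of a module functional at sections of pointwise norm at most one are bounded in
`L^q`: the functional is tested with the multiples `(ω v) ^ (q - 1) v`, cut off to a set of finite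
measure on which `ω v` is bounded. -/
theorem lintegral_ofReal_rpow_le [Fact (1 ≤ p)] (hp' : p ≠ ∞) (hq' : q ≠ ∞)
    [p.HolderConjugate q] [SigmaFinite μ] (ω : E.moduleDual p μ) (v : E.sectionSpace p μ)
    (hv : ∀ᵐ x ∂μ, ‖(v : Lp B p μ) x‖ ≤ 1) :
    ∫⁻ x, ENNReal.ofReal (ω.1 v x) ^ q.toReal ∂μ ≤
      ENNReal.ofReal ‖integralFunctional ω‖ ^ q.toReal := by
  have hpq : p.toReal.HolderConjugate q.toReal :=
    ENNReal.HolderConjugate.toReal_of_ne_top hp' hq'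
  set r := p.toReal with hr
  set s := q.toReal with hs
  have hs1 : 1 < s := hpq.symm.lt
  have hr1 : 1 < r := hpq.lt
  set K := ‖integralFunctional ω‖ with hK
  have hK0 : 0 ≤ K := ContinuousLinearMap.opNorm_nonneg _
  set h : X → ℝ := fun x => ω.1 v x with hh
  have hhm : Measurable h := (Lp.stronglyMeasurable (ω.1 v)).measurable
  set A : ℕ → Set X := fun n => spanningSets μ n ∩ {x | 0 ≤ h x ∧ h x ≤ n} with hA
  have hAm : ∀ n, MeasurableSet (A n) := fun n => (measurableSet_spanningSets μ n).inter
    ((measurableSet_le measurable_const hhm).inter (measurableSet_le hhm measurable_const))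
  have hbound : ∀ n, ∫⁻ x in A n, ENNReal.ofReal (h x) ^ s ∂μ ≤ ENNReal.ofReal K ^ s := by
    intro n
    have hfm : Measurable ((A n).indicator fun x => h x ^ (s - 1)) :=
      (hhm.pow_const _).indicator (hAm n)
    have hfb : ∀ x, |(A n).indicator (fun x => h x ^ (s - 1)) x| ≤ (n : ℝ) ^ (s - 1) := by
      intro x
      by_cases hx : x ∈ A n
      · rw [Set.indicator_of_mem hx, abs_of_nonneg (Real.rpow_nonneg hx.2.1 _)]
        exact Real.rpow_le_rpow hx.2.1 hx.2.2 (by linarith)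
      · rw [Set.indicator_of_notMem hx, abs_zero]
        positivity
    set f := boundedToLp μ _ hfm _ hfb with hf
    have hfe : f =ᵐ[μ] (A n).indicator fun x => h x ^ (s - 1) := coeFn_boundedToLp _ _ _ _
    set I := ∫ x in A n, h x ^ s ∂μ with hI
    have hI0 : 0 ≤ I := setIntegral_nonneg (hAm n) fun x hx => Real.rpow_nonneg hx.2.1 _
    have hIi : IntegrableOn (fun x => h x ^ s) (A n) μ := by
      refine Measure.integrableOn_of_bounded (M := (n : ℝ) ^ s) ?_
        (hhm.pow_const s).aestronglyMeasurable ?_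
      · exact ((measure_mono Set.inter_subset_left).trans_lt
          (measure_spanningSets_lt_top μ n)).ne
      · refine (ae_restrict_iff' (hAm n)).2 (Eventually.of_forall fun x hx => ?_)
        rw [Real.norm_of_nonneg (Real.rpow_nonneg hx.2.1 _)]
        exact Real.rpow_le_rpow hx.2.1 hx.2.2 (by linarith)
    have h1 : integralFunctional ω (mulSection f v) = I := by
      rw [integralFunctional_mulSection, hI, ← integral_indicator (hAm n)]
      refine integral_congr_ae ?_
      filter_upwards [hfe] with x hx
      rw [hx]
      by_cases hxA : x ∈ A n
      · rw [Set.indicator_of_mem hxA, Set.indicator_of_mem hxA]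
        change h x ^ (s - 1) * h x = h x ^ s
        rw [← Real.rpow_add_one' hxA.2.1 (by linarith), sub_add_cancel]
      · rw [Set.indicator_of_notMem hxA, Set.indicator_of_notMem hxA, zero_mul]
    have h2 : ‖mulSection f v‖ ^ r ≤ I := by
      refine (norm_rpow_eq_integral hp' ((mulSection f v : E.sectionSpace p μ) :
        Lp B p μ)).le.trans ?_
      rw [hI, ← integral_indicator (hAm n)]
      refine integral_mono_of_nonneg (Eventually.of_forall fun x => by positivity)
        ((integrable_indicator_iff (hAm n)).2 hIi) ?_
      filter_upwards [coeFn_mulSection f v, hfe, hv] with x e1 e2 e3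
      change _ ^ r ≤ _
      rw [e1, e2, norm_smul]
      by_cases hxA : x ∈ A n
      · rw [Set.indicator_of_mem hxA, Set.indicator_of_mem hxA,
          Real.norm_of_nonneg (Real.rpow_nonneg hxA.2.1 _)]
        calc (h x ^ (s - 1) * ‖(v : Lp B p μ) x‖) ^ r ≤ (h x ^ (s - 1)) ^ r := by
              refine Real.rpow_le_rpow (mul_nonneg (Real.rpow_nonneg hxA.2.1 _) (norm_nonneg _)) ?_
                (by linarith)
              exact mul_le_of_le_one_right (Real.rpow_nonneg hxA.2.1 _) e3
          _ = h x ^ s := by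
              rw [← Real.rpow_mul hxA.2.1, hpq.symm.sub_one_mul_conj]
      · rw [Set.indicator_of_notMem hxA, Set.indicator_of_notMem hxA, norm_zero, zero_mul,
          Real.zero_rpow (by linarith)]
    have h3 : I ≤ K * I ^ (1 / r) := by
      calc I = integralFunctional ω (mulSection f v) := h1.symm
        _ ≤ K * ‖mulSection f v‖ := (le_abs_self _).trans ((integralFunctional ω).le_opNorm _)
        _ ≤ K * I ^ (1 / r) := by
          gcongr
          rw [one_div, Real.le_rpow_inv_iff_of_pos (norm_nonneg _) hI0 (by linarith)]
          exact h2
    have h4 : I ≤ K ^ s := by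
      rcases hI0.eq_or_lt with h0 | h0
      · rw [← h0]
        positivity
      · have h5 : I ^ (1 / s) ≤ K := by
          have h6 : I ^ (1 / s) * I ^ (1 / r) = I := by
            rw [← Real.rpow_add h0, one_div, one_div, add_comm, hpq.inv_add_inv_eq_one,
              Real.rpow_one]
          have h7 : 0 < I ^ (1 / r) := Real.rpow_pos_of_pos h0 _
          refine le_of_mul_le_mul_right ?_ h7
          rw [h6]
          exact h3
        rw [one_div] at h5
        exact (Real.rpow_inv_le_iff_of_pos hI0 hK0 (by linarith)).1 h5
    calc ∫⁻ x in A n, ENNReal.ofReal (h x) ^ s ∂μ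
        = ∫⁻ x in A n, ENNReal.ofReal (h x ^ s) ∂μ :=
          setLIntegral_congr_fun (hAm n) fun x hx =>
            ENNReal.ofReal_rpow_of_nonneg hx.2.1 (by linarith)
      _ = ENNReal.ofReal I := by
          rw [hI, ofReal_integral_eq_lintegral_ofReal hIi]
          exact (ae_restrict_iff' (hAm n)).2
            (Eventually.of_forall fun x hx => Real.rpow_nonneg hx.2.1 _)
      _ ≤ ENNReal.ofReal (K ^ s) := ENNReal.ofReal_le_ofReal h4
      _ = ENNReal.ofReal K ^ s := (ENNReal.ofReal_rpow_of_nonneg hK0 (by linarith)).symm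
  -- The sets exhaust the set where `ω v` is nonnegative.
  have hAmono : Monotone A := fun m n hmn => Set.inter_subset_inter (monotone_spanningSets μ hmn)
    fun x hx => ⟨hx.1, hx.2.trans (by exact_mod_cast hmn)⟩
  have hU : ∀ x, ENNReal.ofReal (h x) ^ s =
      (⋃ n, A n).indicator (fun x => ENNReal.ofReal (h x) ^ s) x := by
    intro x
    by_cases hx : x ∈ ⋃ n, A n
    · rw [Set.indicator_of_mem hx]
    · rw [Set.indicator_of_notMem hx]
      have hneg : h x < 0 := by
        by_contra hge
        obtain ⟨m, hm⟩ : ∃ m, x ∈ spanningSets μ m := by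
          rw [← Set.mem_iUnion, iUnion_spanningSets]
          trivial
        obtain ⟨n, hn⟩ := exists_nat_ge (h x)
        exact hx (Set.mem_iUnion.2 ⟨max m n, monotone_spanningSets μ (le_max_left m n) hm,
          not_lt.1 hge, hn.trans (by exact_mod_cast le_max_right m n)⟩)
      rw [ENNReal.ofReal_of_nonpos hneg.le, ENNReal.zero_rpow_of_pos (by linarith)]
  change ∫⁻ x, ENNReal.ofReal (h x) ^ s ∂μ ≤ _
  rw [lintegral_congr hU, lintegral_indicator (MeasurableSet.iUnion hAm),
    setLIntegral_iUnion_of_directed _ (directed_of_isDirected_le hAmono)]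
  exact iSup_le hbound

/-- The maximum of two values of a module functional at sections of pointwise norm at most one is
again such a value: the two sections are glued together. -/
theorem exists_section_eq_max [Fact (1 ≤ p)] (ω : E.moduleDual p μ) (v w : E.sectionSpace p μ)
    (hv : ∀ᵐ x ∂μ, ‖(v : Lp B p μ) x‖ ≤ 1) (hw : ∀ᵐ x ∂μ, ‖(w : Lp B p μ) x‖ ≤ 1) :
    ∃ u : E.sectionSpace p μ, (∀ᵐ x ∂μ, ‖(u : Lp B p μ) x‖ ≤ 1) ∧
      ∀ᵐ x ∂μ, ω.1 u x = max (ω.1 v x) (ω.1 w x) := by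
  classical
  set A : Set X := {x | ω.1 w x ≤ ω.1 v x} with hA
  have hAm : MeasurableSet A := measurableSet_le (Lp.stronglyMeasurable (ω.1 w)).measurable
    (Lp.stronglyMeasurable (ω.1 v)).measurable
  have hind : ∀ s : Set X, ∀ x, |s.indicator (1 : X → ℝ) x| ≤ 1 := fun s x => by
    by_cases hx : x ∈ s <;> simp [hx]
  set f := boundedToLp μ (A.indicator 1) (measurable_one.indicator hAm) 1 (hind A) with hf
  set g := boundedToLp μ (Aᶜ.indicator 1) (measurable_one.indicator hAm.compl) 1 (hind Aᶜ) with hg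
  have hfe : f =ᵐ[μ] A.indicator 1 := coeFn_boundedToLp _ _ _ _
  have hge : g =ᵐ[μ] Aᶜ.indicator 1 := coeFn_boundedToLp _ _ _ _
  refine ⟨mulSection f v + mulSection g w, ?_, ?_⟩
  · filter_upwards [coeFn_section_add (mulSection f v) (mulSection g w), coeFn_mulSection f v,
      coeFn_mulSection g w, hfe, hge, hv, hw] with x e1 e2 e3 e4 e5 e6 e7
    rw [e1, e2, e3, e4, e5]
    by_cases hx : x ∈ A
    · simpa [hx] using e6
    · simpa [hx] using e7
  · rw [map_add]
    filter_upwards [Lp.coeFn_add (ω.1 (mulSection f v)) (ω.1 (mulSection g w)),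
      coeFn_moduleDual_mulSection ω f v, coeFn_moduleDual_mulSection ω g w, hfe, hge]
      with x e1 e2 e3 e4 e5
    rw [e1, Pi.add_apply, e2, e3, e4, e5]
    by_cases hx : x ∈ A
    · have h1 : ω.1 w x ≤ ω.1 v x := hx
      simpa [hx] using h1
    · simpa [hx] using (not_le.1 hx).le

/-- A module functional which is bounded by `g` at all sections of pointwise norm at most one is
bounded by `g ‖v‖` at every section `v`, by homogeneity. -/
theorem abs_le_mul_norm_of_forall_le [Fact (1 ≤ p)] (ω : E.moduleDual p μ) (g : X → ℝ)
    (hg : ∀ w : E.sectionSpace p μ, (∀ᵐ x ∂μ, ‖(w : Lp B p μ) x‖ ≤ 1) → ∀ᵐ x ∂μ, ω.1 w x ≤ g x)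
    (v : E.sectionSpace p μ) : ∀ᵐ x ∂μ, |ω.1 v x| ≤ g x * ‖(v : Lp B p μ) x‖ := by
  have key : ∀ v : E.sectionSpace p μ, ∀ᵐ x ∂μ, ω.1 v x ≤ g x * ‖(v : Lp B p μ) x‖ := by
    intro v
    have hn : ∀ n : ℕ, ∀ᵐ x ∂μ, ω.1 v x ≤ g x * max ‖(v : Lp B p μ) x‖ (1 / ((n : ℝ) + 1)) := by
      intro n
      have hpos : ∀ x, 0 < max ‖(v : Lp B p μ) x‖ (1 / ((n : ℝ) + 1)) := fun x =>
        lt_max_of_lt_right (by positivity)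
      -- Division by the norm, truncated away from zero to obtain a bounded multiplier.
      set f := boundedToLp μ (fun x => (max ‖(v : Lp B p μ) x‖ (1 / ((n : ℝ) + 1)))⁻¹)
        (((Lp.stronglyMeasurable (v : Lp B p μ)).norm.measurable.max measurable_const).inv)
        ((n : ℝ) + 1) (fun x => by
          rw [abs_of_pos (inv_pos.2 (hpos x)), inv_le_comm₀ (hpos x) (by positivity), ← one_div]
          exact le_max_right _ _) with hf
      have hfe := coeFn_boundedToLp (μ := μ)
        (fun x => (max ‖(v : Lp B p μ) x‖ (1 / ((n : ℝ) + 1)))⁻¹)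
        (((Lp.stronglyMeasurable (v : Lp B p μ)).norm.measurable.max measurable_const).inv)
        ((n : ℝ) + 1) (fun x => by
          rw [abs_of_pos (inv_pos.2 (hpos x)), inv_le_comm₀ (hpos x) (by positivity), ← one_div]
          exact le_max_right _ _)
      have hunit : ∀ᵐ x ∂μ, ‖((mulSection f v : E.sectionSpace p μ) : Lp B p μ) x‖ ≤ 1 := by
        filter_upwards [coeFn_mulSection f v, hfe] with x e1 e2
        rw [e1, e2, norm_smul, Real.norm_of_nonneg (inv_pos.2 (hpos x)).le,
          inv_mul_le_one₀ (hpos x)]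
        exact le_max_left _ _
      filter_upwards [hg _ hunit, coeFn_moduleDual_mulSection ω f v, hfe] with x e1 e2 e3
      rwa [e2, e3, inv_mul_le_iff₀ (hpos x), mul_comm] at e1
    filter_upwards [ae_all_iff.2 hn] with x hx
    have h1 : Tendsto (fun n : ℕ => g x * max ‖(v : Lp B p μ) x‖ (1 / ((n : ℝ) + 1))) atTop
        (𝓝 (g x * max ‖(v : Lp B p μ) x‖ 0)) :=
      (tendsto_const_nhds.max tendsto_one_div_add_atTop_nhds_zero_nat).const_mul _
    rw [max_eq_left (norm_nonneg _)] at h1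
    exact ge_of_tendsto' h1 hx
  have hneg := key (-v)
  rw [map_neg] at hneg
  filter_upwards [key v, hneg, Lp.coeFn_neg (ω.1 v), Lp.coeFn_neg (v : Lp B p μ)] with x e1 e2 e3 e4
  rw [e3, Pi.neg_apply, Submodule.coe_neg, e4, Pi.neg_apply, norm_neg] at e2
  exact abs_le.2 ⟨by linarith, e1⟩

/-- Every module functional has a pointwise norm, and the `L^q` norm of the latter is at most the
norm of the associated functional. -/
theorem exists_isPointwiseNorm [Fact (1 ≤ p)] (hp' : p ≠ ∞) (hq : 1 < q) (hq' : q ≠ ∞)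
    [p.HolderConjugate q] [SigmaFinite μ] (ω : E.moduleDual p μ) :
    ∃ g : Lp ℝ q μ, IsPointwiseNorm ω (g : X →ₘ[μ] ℝ) ∧
      eLpNorm g q μ ≤ ENNReal.ofReal ‖integralFunctional ω‖ ∧
      ∀ v : E.sectionSpace p μ, ∀ᵐ x ∂μ, |ω.1 v x| ≤ g x * ‖(v : Lp B p μ) x‖ := by
  have hq0 : q ≠ 0 := (zero_lt_one.trans hq).ne'
  have hs0 : 0 < q.toReal := ENNReal.toReal_pos hq0 hq'
  set s := q.toReal with hs
  set K := ‖integralFunctional ω‖ with hK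
  set H : Set (X → ℝ≥0∞) := {h | ∃ v : E.sectionSpace p μ,
    (∀ᵐ x ∂μ, ‖(v : Lp B p μ) x‖ ≤ 1) ∧ h = fun x => ENNReal.ofReal (ω.1 v x) ^ s} with hH
  have hzero : ∀ᵐ x ∂μ, ‖((0 : E.sectionSpace p μ) : Lp B p μ) x‖ ≤ 1 := by
    filter_upwards [Lp.coeFn_zero B p μ] with x hx
    rw [Submodule.coe_zero, hx]
    simp
  have hmv : ∀ v : E.sectionSpace p μ, Measurable fun x => ENNReal.ofReal (ω.1 v x) ^ s := fun v =>
    ((Lp.stronglyMeasurable (ω.1 v)).measurable.ennreal_ofReal).pow_const s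
  obtain ⟨k, hkH, hkC, hkle⟩ := exists_seq_ae_le_iSup (μ := μ) (H := H)
    (C := ENNReal.ofReal K ^ s) ⟨_, 0, hzero, rfl⟩
    (by
      rintro _ ⟨v, -, rfl⟩
      exact (hmv v).aemeasurable)
    (by
      rintro _ ⟨v, hv, rfl⟩ _ ⟨w, hw, rfl⟩
      obtain ⟨u, hu, hmax⟩ := exists_section_eq_max ω v w hv hw
      refine ⟨_, ⟨u, hu, rfl⟩, ?_⟩
      filter_upwards [hmax] with x hx
      refine max_le ?_ ?_ <;> rw [hx] <;> gcongr
      · exact le_max_left _ _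
      · exact le_max_right _ _)
    (by finiteness)
    (by
      rintro _ ⟨v, hv, rfl⟩
      exact lintegral_ofReal_rpow_le hp' hq' ω v hv)
  choose v hv hkv using hkH
  obtain rfl : k = fun n x => ENNReal.ofReal (ω.1 (v n) x) ^ s := funext hkv
  set G : X → ℝ≥0∞ := fun x => ⨆ n, ENNReal.ofReal (ω.1 (v n) x) ^ s with hG
  have hGm : Measurable G := Measurable.iSup fun n => hmv (v n)
  have hGfin : ∀ᵐ x ∂μ, G x < ∞ :=
    ae_lt_top hGm (hkC.trans_lt (by finiteness)).ne
  set g₀ : X → ℝ := fun x => (G x ^ s⁻¹).toReal with hg₀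
  have hg₀m : Measurable g₀ := (hGm.pow_const s⁻¹).ennreal_toReal
  have hg₀G : ∀ x, G x < ∞ → ENNReal.ofReal (g₀ x) ^ s = G x := fun x hx => by
    rw [hg₀, ENNReal.ofReal_toReal (by
      exact ENNReal.rpow_ne_top_of_nonneg (inv_nonneg.2 hs0.le) hx.ne), ← ENNReal.rpow_mul,
      inv_mul_cancel₀ hs0.ne', ENNReal.rpow_one]
  have hg₀0 : ∀ x, 0 ≤ g₀ x := fun x => ENNReal.toReal_nonneg
  have hnorm : eLpNorm g₀ q μ ≤ ENNReal.ofReal K := by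
    rw [eLpNorm_eq_lintegral_rpow_enorm_toReal hq0 hq', one_div, ENNReal.rpow_inv_le_iff hs0]
    refine le_trans (le_of_eq ?_) hkC
    refine lintegral_congr_ae ?_
    filter_upwards [hGfin] with x hx
    change ‖g₀ x‖ₑ ^ s = G x
    rw [Real.enorm_of_nonneg (hg₀0 x), hg₀G x hx]
  have hmem : MemLp g₀ q μ := ⟨hg₀m.aestronglyMeasurable, hnorm.trans_lt ENNReal.ofReal_lt_top⟩
  have hge : (hmem.toLp g₀ : X → ℝ) =ᵐ[μ] g₀ := hmem.coeFn_toLp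
  have hunit : ∀ w : E.sectionSpace p μ, (∀ᵐ x ∂μ, ‖(w : Lp B p μ) x‖ ≤ 1) →
      ∀ᵐ x ∂μ, ω.1 w x ≤ g₀ x := by
    intro w hw
    filter_upwards [hkle _ ⟨w, hw, rfl⟩, hGfin] with x h1 h2
    have h3 : ENNReal.ofReal (ω.1 w x) ^ s ≤ ENNReal.ofReal (g₀ x) ^ s := by
      rw [hg₀G x h2]
      exact h1
    exact (ENNReal.ofReal_le_ofReal_iff (hg₀0 x)).1 ((ENNReal.rpow_le_rpow_iff hs0).1 h3)
  have hext : ∀ f : X →ₘ[μ] ℝ, toExtended f =ᵐ[μ] fun x => ((f x : ℝ) : EReal) := fun f =>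
    AEEqFun.coeFn_comp _ _ _
  refine ⟨hmem.toLp g₀, ⟨?_, ?_⟩, ?_, ?_⟩
  · rintro _ ⟨w, hw, rfl⟩
    rw [← AEEqFun.coeFn_le]
    filter_upwards [hext (ω.1 w : X →ₘ[μ] ℝ), hext (hmem.toLp g₀ : X →ₘ[μ] ℝ), hunit w hw, hge]
      with x e1 e2 e3 e4
    rw [e1, e2, EReal.coe_le_coe_iff]
    exact e3.trans e4.ge
  · intro u hu
    have hle : ∀ w : E.sectionSpace p μ, (∀ᵐ x ∂μ, ‖(w : Lp B p μ) x‖ ≤ 1) →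
        ∀ᵐ x ∂μ, ((ω.1 w x : ℝ) : EReal) ≤ u x := by
      intro w hw
      have h1 := AEEqFun.coeFn_le.2 (hu ⟨w, hw, rfl⟩)
      filter_upwards [h1, hext (ω.1 w : X →ₘ[μ] ℝ)] with x e1 e2
      rw [e2] at e1
      exact e1
    have h0 := hle 0 hzero
    rw [map_zero] at h0
    rw [← AEEqFun.coeFn_le]
    filter_upwards [hext (hmem.toLp g₀ : X →ₘ[μ] ℝ), hge, ae_all_iff.2 fun n => hle (v n) (hv n),
      h0, Lp.coeFn_zero ℝ 1 μ, hGfin] with x e1 e2 e3 e4 e5 e6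
    rw [e5, Pi.zero_apply, EReal.coe_zero] at e4
    rw [e1]
    refine (EReal.coe_le_coe_iff.2 e2.le).trans ?_
    induction hux : u x with
    | bot => simp [hux] at e4
    | top => exact le_top
    | coe c =>
      rw [hux] at e4
      simp only [hux, EReal.coe_le_coe_iff] at e3
      have hc : 0 ≤ c := by exact_mod_cast e4
      rw [EReal.coe_le_coe_iff]
      have h1 : G x ≤ ENNReal.ofReal c ^ s := iSup_le fun n => by
        gcongr
        exact e3 n
      rw [← hg₀G x e6, ENNReal.rpow_le_rpow_iff hs0] at h1
      exact (ENNReal.ofReal_le_ofReal_iff hc).1 h1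
  · rwa [eLpNorm_congr_ae hge]
  · intro w
    filter_upwards [abs_le_mul_norm_of_forall_le ω g₀ hunit w, hge] with x e1 e2
    rwa [e2]

end BanachBundle

namespace BanachBundle

variable {X : Type*} [MeasurableSpace X] {μ : Measure X}
  {B : Type*} [NormedAddCommGroup B] [NormedSpace ℝ B] {E : BanachBundle X B} {p q : ℝ≥0∞}

/-! ### Reflexivity of the space of sections -/

/-- A module functional with pointwise norm at most `g` acts on a sequence of sections through a
functional on `B` of norm at most `g x` at almost every point `x`. -/
theorem exists_pointwise_functional [Fact (1 ≤ p)] (ω : E.moduleDual p μ) (g : X → ℝ)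
    (hg : ∀ v : E.sectionSpace p μ, ∀ᵐ x ∂μ, |ω.1 v x| ≤ g x * ‖(v : Lp B p μ) x‖)
    (u : ℕ → E.sectionSpace p μ) :
    ∃ ψ : X → StrongDual ℝ B, ∀ᵐ x ∂μ, ‖ψ x‖ ≤ |g x| ∧
      ∀ n, ψ x ((u n : Lp B p μ) x) = ω.1 (u n) x := by
  have h1 : ∀ᵐ x ∂μ, ∀ c : ℕ →₀ ℚ, |c.sum fun n r => (r : ℝ) * ω.1 (u n) x| ≤
      g x * ‖c.sum fun n r => (r : ℝ) • (u n : Lp B p μ) x‖ := by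
    refine ae_all_iff.2 fun c => ?_
    have e1 : ω.1 (∑ n ∈ c.support, (c n : ℝ) • u n) = ∑ n ∈ c.support, (c n : ℝ) • ω.1 (u n) := by
      simp only [map_sum, map_smul]
    have e2 : ((∑ n ∈ c.support, (c n : ℝ) • u n : E.sectionSpace p μ) : Lp B p μ) =
        ∑ n ∈ c.support, (c n : ℝ) • (u n : Lp B p μ) := by
      simp
    have h := hg (∑ n ∈ c.support, (c n : ℝ) • u n)
    rw [e1, e2] at h
    filter_upwards [h, Lp.coeFn_fun_finsetSum c.support fun n => (c n : ℝ) • ω.1 (u n),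
      Lp.coeFn_fun_finsetSum c.support fun n => (c n : ℝ) • (u n : Lp B p μ),
      ae_all_iff.2 fun n => Lp.coeFn_smul (c n : ℝ) (ω.1 (u n)),
      ae_all_iff.2 fun n => Lp.coeFn_smul (c n : ℝ) (u n : Lp B p μ)] with x f1 f2 f3 f4 f5
    rw [f2, f3] at f1
    simpa only [f4, f5, Pi.smul_apply, smul_eq_mul, Finsupp.sum] using f1
  refine (Filter.skolem (α := fun _ : X => StrongDual ℝ B) (F := ae μ) (P := fun x ψ =>
    ‖ψ‖ ≤ |g x| ∧ ∀ n, ψ ((u n : Lp B p μ) x) = ω.1 (u n) x)).1 ?_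
  filter_upwards [h1] with x hx
  obtain ⟨ψ, hψ, hψn⟩ := exists_strongDual_apply_eq _ _ _ hx
  exact ⟨ψ, hψ.trans (max_le (le_abs_self _) (abs_nonneg _)), hψn⟩

/-- The `L^p` space of sections of a reflexive bundle is a reflexive Banach space. -/
theorem isReflexiveSpace_sectionSpace [CompleteSpace B] [SigmaFinite μ] [Fact (1 ≤ p)]
    (hp : 1 < p) (hp' : p ≠ ∞) (hE : E.IsReflexive μ) :
    IsReflexiveSpace (E.sectionSpace p μ) := by
  by_contra hV
  have : CompleteSpace (E.sectionSpace p μ) :=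
    (isClosed_sectionSpace (E := E) (p := p) (μ := μ)).completeSpace_coe
  obtain ⟨K, u, φ, huK, hφK, h1, h0⟩ := exists_triangular_of_not_isReflexiveSpace hV
  set q := p.conjExponent with hq
  have hq1 : 1 < q := (ENNReal.HolderConjugate.lt_top_iff_one_lt p q).1 hp'.lt_top
  have hq' : q ≠ ∞ := ((ENNReal.HolderConjugate.lt_top_iff_one_lt q p).2 hp).ne
  choose ω hω using fun k => integralFunctional_surjective (E := E) (μ := μ) hp' (φ k)
  choose g hgω hgK hgv using fun k => exists_isPointwiseNorm (E := E) (μ := μ) hp' hq1 hq' (ω k)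
  choose ψ hψ using fun k => exists_pointwise_functional (ω k) (g k) (hgv k) u
  have hψu : ∀ k n, (fun x => ψ k x ((u n : Lp B p μ) x)) =ᵐ[μ] (ω k).1 (u n) := fun k n => by
    filter_upwards [hψ k] with x hx
    exact hx.2 n
  have hint : ∀ k n, ∫ x, ψ k x ((u n : Lp B p μ) x) ∂μ = φ k (u n) := fun k n => by
    rw [integral_congr_ae (hψu k n), ← integralFunctional_apply, hω k]
  refine not_triangular_integral hp hp' hq1 hq' (fun x => E.fiber x) hE K
    (fun n => (u n : Lp B p μ)) (fun n => Lp.memLp _) (fun n => ae_mem_fiber (u n)) (fun n => ?_)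
    ψ (fun k x => |g k x|) (fun k => (Lp.memLp (g k)).abs) (fun k => ?_)
    (fun k => (hψ k).mono fun x hx => hx.1)
    (fun k n => ((Lp.stronglyMeasurable ((ω k).1 (u n))).measurable.aemeasurable).congr
      (hψu k n).symm)
    (fun k n hkn => by rw [hint, h1 k n hkn]) (fun k n hnk => by rw [hint, h0 k n hnk])
  · rw [← Lp.enorm_def, ← ofReal_norm]
    exact ENNReal.ofReal_le_ofReal (huK n)
  · refine ((eLpNorm_norm _).trans_le (hgK k)).trans ?_
    rw [hω k]
    exact ENNReal.ofReal_le_ofReal (hφK k)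

theorem integralFunctional_injective [Fact (1 ≤ p)] :
    Function.Injective (integralFunctional (E := E) (p := p) (μ := μ)) := by
  intro ω ω' h
  refine Subtype.ext (ContinuousLinearMap.ext fun v => L1_ext_of_integral_mul fun f => ?_)
  rw [← integralFunctional_mulSection, ← integralFunctional_mulSection, h]

/-- Reflexivity as a Banach space implies reflexivity as a module: integration turns an element of
the module bidual into an element of the bidual, and the section representing the latter is tested
with the multiples of a module functional by bounded functions. -/
theorem isReflexiveModule_of_isReflexiveSpace [SigmaFinite μ] [Fact (1 ≤ p)]
    (hp : 1 < p) (hp' : p ≠ ∞) (h : IsReflexiveSpace (E.sectionSpace p μ)) :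
    E.IsReflexiveModule p μ := by
  rintro L ⟨hL, C, hC⟩
  have hq1 : 1 < p.conjExponent :=
    (ENNReal.HolderConjugate.lt_top_iff_one_lt p p.conjExponent).1 hp'.lt_top
  have hq' : p.conjExponent ≠ ∞ :=
    ((ENNReal.HolderConjugate.lt_top_iff_one_lt p.conjExponent p).2 hp).ne
  have : Fact (1 ≤ p.conjExponent) := ⟨hq1.le⟩
  choose σ hσ using integralFunctional_surjective (E := E) (μ := μ) hp'
  have hσω : ∀ ω, σ (integralFunctional ω) = ω := fun ω => integralFunctional_injective (hσ _)
  have hadd : ∀ φ φ', σ (φ + φ') = σ φ + σ φ' := fun φ φ' => by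
    refine integralFunctional_injective ?_
    rw [hσ]
    conv_lhs => rw [← hσ φ, ← hσ φ']
    exact (ContinuousLinearMap.comp_add _ _ _).symm
  have hsmul : ∀ (c : ℝ) φ, σ (c • φ) = c • σ φ := fun c φ => by
    refine integralFunctional_injective ?_
    rw [hσ]
    conv_lhs => rw [← hσ φ]
    exact (ContinuousLinearMap.comp_smul _ _ _).symm
  have hbd : ∀ φ, ‖L1.integralCLM (α := X) (E := ℝ) (μ := μ) (L (σ φ))‖ ≤ |C| * ‖φ‖ := by
    intro φ
    obtain ⟨g, hg, hgn, -⟩ := exists_isPointwiseNorm (E := E) (μ := μ) hp' hq1 hq' (σ φ)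
    rw [hσ] at hgn
    have h2 : ‖g‖ ≤ ‖φ‖ := by
      rw [Lp.norm_def]
      exact ENNReal.toReal_le_of_le_ofReal (ContinuousLinearMap.opNorm_nonneg _) hgn
    calc ‖L1.integralCLM (α := X) (E := ℝ) (μ := μ) (L (σ φ))‖ ≤ ‖L (σ φ)‖ := by
          have := L1.norm_integral_le (L (σ φ))
          rwa [L1.integral_eq] at this
      _ ≤ C * ‖g‖ := hC _ _ hg
      _ ≤ |C| * ‖g‖ := mul_le_mul_of_nonneg_right (le_abs_self C) (norm_nonneg _)
      _ ≤ |C| * ‖φ‖ := by gcongr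
  set Φ : StrongDual ℝ (StrongDual ℝ (E.sectionSpace p μ)) :=
    LinearMap.mkContinuous
      { toFun := fun φ => L1.integralCLM (α := X) (E := ℝ) (μ := μ) (L (σ φ))
        map_add' := fun φ φ' => by rw [hadd, map_add, map_add]
        map_smul' := fun c φ => by rw [hsmul, map_smul, map_smul]; rfl } |C| hbd with hΦ
  obtain ⟨v, hv⟩ := h Φ
  have hvω : ∀ ω : E.moduleDual p μ, ∫ x, ω.1 v x ∂μ = ∫ x, L ω x ∂μ := by
    intro ω
    have h1 := DFunLike.congr_fun hv (integralFunctional ω)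
    rw [NormedSpace.dual_def, integralFunctional_apply] at h1
    rw [h1, ← L1.integral_eq_integral, L1.integral_eq]
    change L1.integralCLM (α := X) (E := ℝ) (μ := μ) (L (σ (integralFunctional ω))) = _
    rw [hσω]
  refine ⟨v, fun ω => L1_ext_of_integral_mul fun f => ?_⟩
  have h1 := hvω (mulDual f ω)
  rw [hL f ω] at h1
  have h2 : (mulDual f ω).1 v = (f • ω.1 v : Lp ℝ 1 μ) := rfl
  rw [h2] at h1
  have e1 := integral_congr_ae (Lp.coeFn_lpSMul (r := 1) f (ω.1 v))
  have e2 := integral_congr_ae (Lp.coeFn_lpSMul (r := 1) f (L ω))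
  exact (e2.symm.trans h1.symm).trans e1

end BanachBundle

theorem theorem3p9 {X : Type*} [MeasurableSpace X] (μ : Measure X) [SigmaFinite μ]
    {B : Type*} [NormedAddCommGroup B] [NormedSpace ℝ B] [CompleteSpace B]
    [TopologicalSpace.SeparableSpace B]
    (E : BanachBundle X B) (hE : E.IsReflexive μ)
    (p : ℝ≥0∞) [Fact (1 ≤ p)] (hp : 1 < p) (hp' : p < ∞) :
    IsReflexiveSpace (E.sectionSpace p μ) ∧ E.IsReflexiveModule p μ := by
  have h := BanachBundle.isReflexiveSpace_sectionSpace hp hp'.ne hE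
  exact ⟨h, BanachBundle.isReflexiveModule_of_isReflexiveSpace hp hp'.ne h⟩
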